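/- Let $M,N\ge 1$ be integers, $\sigma_Z^2>0$, and let $\Sigma\in\mathbb C^{MN\times MN}$ be a Hermitian positive definite matrix. Consider the Rayleigh fading channel with inputs $x\in\mathbb C^N$, outputs $y\in\mathbb C^M$ and transition density $$p(y|x)=\frac{\exp\!\big(-\operatorname{tr}[K(x)^{-1}yy^H]\big)}{\pi^M\det K(x)},\qquad K(x)=\sigma_Z^2\mathbf 1_M+(\mathbf 1_M\otimes x^H)\,\Sigma\,(\mathbf 1_M\otimes x),$$ with respect to Lebesgue measure on $\mathbb C^M$. For a Borel probability measure $\mu$ on $\mathbb C^N$ put $f_\mu(y)=\int p(y|x)\,\mu(dx)$ and $$I(\mu;W)=\int\!\!\int p(y|x)\log\frac{p(y|x)}{f_\mu(y)}\,dy\,\mu(dx),$$ where $\log$ is the natural logarithm. For $a>0$ let $C(a)=\sup_\mu I(\mu;W)$, the supremum being over all Borel probability measures $\mu$ on $\mathbb C^N$ with $\int\frac1N\|x\|^2\,d\mu\le a$; such a $\mu$ is called capacity achieving if $I(\mu;W)=C(a)$. A real number $\gamma\ge 0$ is a Lagrange multiplier $\gamma(a)$ of this problem if for some capacity achieving $\mu$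 the Karush–Kuhn–Tucker conditions hold: $$\gamma\Big(\frac1N\|x\|^2-a\Big)+C(a)-\int p(y|x)\log\frac{p(y|x)}{f_\mu(y)}\,dy\ \ge 0\quad\text{for all }x\in\mathbb C^N,$$ with equality for every $x\in\operatorname{supp}(\mu)$. Then for every $a>0$ a Lagrange multiplier exists, and every Lagrange multiplier satisfies $\gamma(a)>0$. -/

import Mathlib

open MeasureTheory
open scoped Matrix Kronecker ComplexOrder

noncomputable section

namespace RayleighFading

variable {M N : ℕ}

/-- The matrix `1_M ⊗ x` of size `MN × M`, for a column vector `x ∈ ℂ^N`. The (one-point) second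
column index of the Kronecker product is dropped. -/
def idKron (M : ℕ) {N : ℕ} (x : Fin N → ℂ) : Matrix (Fin M × Fin N) (Fin M) ℂ :=
  ((1 : Matrix (Fin M) (Fin M) ℂ) ⊗ₖ Matrix.replicateCol Unit x).submatrix id (fun m => (m, ()))

/-- The covariance matrix of the output given the input `x`:
`σ² 1_M + (1_M ⊗ xᴴ) S (1_M ⊗ x)`, where `σ2` is the noise variance and `S` the covariance matrix
of the channel coefficients. -/
def outCov (σ2 : ℝ) (S : Matrix (Fin M × Fin N) (Fin M × Fin N) ℂ) (x : Fin N → ℂ) :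
    Matrix (Fin M) (Fin M) ℂ :=
  (σ2 : ℂ) • (1 : Matrix (Fin M) (Fin M) ℂ) + (idKron M x)ᴴ * S * idKron M x

/-- The conditional density `p(y|x)` of the output, with respect to Lebesgue measure on `ℂ^M`. The
trace and the determinant are real numbers when `σ2 > 0` and `S` is positive definite. -/
def density (σ2 : ℝ) (S : Matrix (Fin M × Fin N) (Fin M × Fin N) ℂ) (x : Fin N → ℂ)
    (y : Fin M → ℂ) : ℝ :=
  Real.exp (-((outCov σ2 S x)⁻¹ * Matrix.vecMulVec y (star y)).trace.re) /
    (Real.pi ^ M * (outCov σ2 S x).det.re)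

/-- The output density `f_μ(y) = ∫ p(y|x) μ(dx)` under the input distribution `μ`. -/
def outDensity (σ2 : ℝ) (S : Matrix (Fin M × Fin N) (Fin M × Fin N) ℂ)
    (μ : Measure (Fin N → ℂ)) (y : Fin M → ℂ) : ℝ :=
  ∫ x, density σ2 S x y ∂μ

/-- `∫ p(y|x) log (p(y|x) / f_μ(y)) dy`. -/
def infoDensity (σ2 : ℝ) (S : Matrix (Fin M × Fin N) (Fin M × Fin N) ℂ)
    (μ : Measure (Fin N → ℂ)) (x : Fin N → ℂ) : ℝ :=
  ∫ y : Fin M → ℂ, density σ2 S x y * Real.log (density σ2 S x y / outDensity σ2 S μ y)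

/-- The mutual information `I(μ; W) = ∫∫ p(y|x) log (p(y|x) / f_μ(y)) dy μ(dx)`. -/
def mutualInfo (σ2 : ℝ) (S : Matrix (Fin M × Fin N) (Fin M × Fin N) ℂ)
    (μ : Measure (Fin N → ℂ)) : ℝ :=
  ∫ x, infoDensity σ2 S μ x ∂μ

/-- The power `(1/N) ‖x‖²` of an input symbol (Euclidean norm). -/
def power (x : Fin N → ℂ) : ℝ :=
  (1 / (N : ℝ)) * ∑ n, ‖x n‖ ^ 2

/-- The input distributions that satisfy the average power constraint `∫ (1/N) ‖x‖² dμ ≤ a`. -/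
def inputs (N : ℕ) (a : ℝ) : Set (Measure (Fin N → ℂ)) :=
  {μ | IsProbabilityMeasure μ ∧ Integrable power μ ∧ ∫ x, power x ∂μ ≤ a}

/-- The capacity `C(a)` under the average power constraint `a`. -/
def capacity (σ2 : ℝ) (S : Matrix (Fin M × Fin N) (Fin M × Fin N) ℂ) (a : ℝ) : ℝ :=
  sSup (mutualInfo σ2 S '' inputs N a)

/-- `μ` is a capacity achieving input distribution under the average power constraint `a`. -/
def AchievesCapacity (σ2 : ℝ) (S : Matrix (Fin M × Fin N) (Fin M × Fin N) ℂ) (a : ℝ)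
    (μ : Measure (Fin N → ℂ)) : Prop :=
  μ ∈ inputs N a ∧ mutualInfo σ2 S μ = capacity σ2 S a

/-- The left-hand side of the Karush-Kuhn-Tucker conditions,
`γ ((1/N) ‖x‖² - a) + C(a) - ∫ p(y|x) log (p(y|x) / f_μ(y)) dy`. -/
def kkt (σ2 : ℝ) (S : Matrix (Fin M × Fin N) (Fin M × Fin N) ℂ) (a γ : ℝ)
    (μ : Measure (Fin N → ℂ)) (x : Fin N → ℂ) : ℝ :=
  γ * (power x - a) + capacity σ2 S a - infoDensity σ2 S μ x

/-- `γ` is a Lagrange multiplier for the capacity problem with average power constraint `a`: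
`γ ≥ 0`, and the Karush-Kuhn-Tucker conditions hold with `γ` at a capacity achieving input
distribution `μ`, that is, `kkt ≥ 0` everywhere, with equality on the support of `μ`. -/
def IsLagrangeMultiplier (σ2 : ℝ) (S : Matrix (Fin M × Fin N) (Fin M × Fin N) ℂ)
    (a γ : ℝ) : Prop :=
  0 ≤ γ ∧ ∃ μ : Measure (Fin N → ℂ), AchievesCapacity σ2 S a μ ∧
    (∀ x, 0 ≤ kkt σ2 S a γ μ x) ∧ ∀ x ∈ μ.support, kkt σ2 S a γ μ x = 0

end RayleighFading

end

/-!
The transition density is abstracted to a kernel `p(y|x)` that is bounded, continuous, of Gaussian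
decay in `y` locally uniformly in `x`, and whose logarithm grows at most quadratically
(`TameKernel`). For a reference density `q` of the same kind, the divergence
`D(x, q) = ∫ p(y|x) log (p(y|x) / q(y)) dy` is a continuous function of `x` of at most quadratic
growth, and mutual information is the least mean divergence: `I(μ) ≤ ∫ D(x, q) dμ` for every
probability density `q`, with equality for `q = f_μ` (`integral_divergence_le`). This one
inequality, which is Gibbs' inequality together with Fubini's theorem, carries the argument.

*The capacity is attained.* The admissible inputs are weakly compact by Prokhorov's theorem
(`isCompact_inputs`). For upper semicontinuity of `I` at `μ`, the mutual information of a nearby `ν`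
is compared with `∫ D(x, q) dν`, where `q` is `f_μ` plus a small multiple of a wide Gaussian. The
Gaussian makes the quadratic growth rate of `D(x, q)` as small as desired, so that the power
constraint controls the part which weak convergence does not see
(`upperSemicontinuousOn_mutualInformation`).

*A multiplier exists.* Moving from an optimal `μ` towards an admissible `ν` gives
`∫ D(x, f_μ) dν ≤ C(a)` (`integral_divergence_le_of_isMaxOn`). For `ν` supported on at most two
points, this says that the points `(power x, D(x, f_μ))` have no convex combination above `C(a)` at
an abscissa `≤ a`, which produces a supporting line of nonnegative slope `γ` through `(a, C(a))`
(`exists_multiplier`). Equality on the support holds because the gap has nonpositive mean under `μ`.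

*Every multiplier is positive.* If `γ = 0`, then `D(x, f_μ) ≤ C(a)` for all `x`. But `f_μ` has a
finite second moment, so that `q = f_μ (1 + ‖y‖²)` has finite mass, and Gibbs' inequality for `q`
gives `D(x, f_μ) ≥ ∫ p(y|x) log (1 + ‖y‖²) dy - const`, which tends to infinity with `x`
(`exists_lt_divergence`).

The Rayleigh fading density is such a kernel (`tameKernel_density`): positive definiteness of the
channel covariance puts the eigenvalues of `K(x)` between `σ² + l ‖x‖²` and `σ² + L ‖x‖²` with
`l > 0`, and the substitution `y = K(x)^{1/2} z` turns integrals against `p(·|x)` into integrals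
against the standard Gaussian (`exists_whitening`).
-/

namespace RayleighFading

noncomputable section

open Filter Topology

/-! ### The squared Euclidean norm -/

/-- The squared Euclidean norm on `ℂⁿ`; the type `Fin n → ℂ` itself carries the sup norm. -/
def sqNorm {n : ℕ} (y : Fin n → ℂ) : ℝ := ∑ i, ‖y i‖ ^ 2

lemma sqNorm_nonneg {n : ℕ} (y : Fin n → ℂ) : 0 ≤ sqNorm y :=
  Finset.sum_nonneg fun _ _ => sq_nonneg _

lemma continuous_sqNorm {n : ℕ} : Continuous (sqNorm : (Fin n → ℂ) → ℝ) := by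
  unfold sqNorm; fun_prop

lemma measurable_sqNorm {n : ℕ} : Measurable (sqNorm : (Fin n → ℂ) → ℝ) :=
  continuous_sqNorm.measurable

lemma integral_exp_neg_sqNorm {n : ℕ} {b : ℝ} (hb : 0 < b) :
    ∫ y : Fin n → ℂ, Real.exp (-(b * sqNorm y)) = (Real.pi / b) ^ n := by
  have h : ∀ y : Fin n → ℂ,
      Real.exp (-(b * sqNorm y)) = ∏ i, Real.exp (-b * ‖y i‖ ^ (2 : ℝ)) := by
    intro y
    rw [← Real.exp_sum]
    simp [sqNorm, Finset.mul_sum]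
  simp_rw [h]
  rw [integral_fintype_prod_volume_eq_pow (fun z : ℂ => Real.exp (-b * ‖z‖ ^ (2 : ℝ))),
    Complex.integral_exp_neg_mul_rpow one_le_two hb]
  norm_num [Real.rpow_neg_one, div_eq_mul_inv]

lemma integrable_exp_neg_sqNorm {n : ℕ} {b : ℝ} (hb : 0 < b) :
    Integrable fun y : Fin n → ℂ => Real.exp (-(b * sqNorm y)) := by
  apply Integrable.of_integral_ne_zero
  rw [integral_exp_neg_sqNorm hb]
  positivity

lemma integrable_one_add_sqNorm_mul_exp {n : ℕ} {b : ℝ} (hb : 0 < b) :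
    Integrable fun y : Fin n → ℂ => (1 + sqNorm y) * Real.exp (-(b * sqNorm y)) := by
  refine Integrable.mono' ((integrable_exp_neg_sqNorm (n := n) (half_pos hb)).const_mul
    (1 + 2 / b)) (by unfold sqNorm; fun_prop) (ae_of_all _ fun y => ?_)
  have h0 := sqNorm_nonneg y
  rw [Real.norm_of_nonneg (by positivity)]
  have h1 : Real.exp (-(b * sqNorm y))
      = Real.exp (-(b / 2 * sqNorm y)) * Real.exp (-(b / 2 * sqNorm y)) := by
    rw [← Real.exp_add]; ring_nf
  have h2 : b / 2 * sqNorm y * Real.exp (-(b / 2 * sqNorm y)) ≤ 1 := by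
    have := Real.add_one_le_exp (b / 2 * sqNorm y)
    rw [Real.exp_neg, ← div_eq_mul_inv, div_le_one (Real.exp_pos _)]
    linarith
  have h3 : Real.exp (-(b / 2 * sqNorm y)) ≤ 1 := Real.exp_le_one_iff.2 (by
    have : 0 ≤ b / 2 * sqNorm y := by positivity
    linarith)
  have h4 : (1 + sqNorm y) * Real.exp (-(b / 2 * sqNorm y)) ≤ 1 + 2 / b := by
    have : sqNorm y * Real.exp (-(b / 2 * sqNorm y)) ≤ 2 / b := by
      rw [le_div_iff₀ hb]; linarith
    linarith
  rw [h1, ← mul_assoc]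
  exact mul_le_mul_of_nonneg_right h4 (Real.exp_pos _).le

/-! ### Tame kernels and tame densities -/

/-- A bounded transition density from `ℂᴺ` to `ℂᴹ` whose logarithm grows at most quadratically,
whose second moment is bounded in terms of the input (`moment`), which has Gaussian decay in the output
locally uniformly in the input (`dominated`), and which spreads out as the input grows (`spread`).
Everything that is said below about mutual information holds for such a kernel. -/
structure TameKernel {N M : ℕ} (p : (Fin N → ℂ) → (Fin M → ℂ) → ℝ) : Prop where
  continuous : Continuous (Function.uncurry p)
  bounded : ∃ c, 1 ≤ c ∧ ∀ x y, p x y ≤ c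
  lower : ∃ A, 0 ≤ A ∧ ∀ x y, Real.exp (-(A * (1 + sqNorm x + sqNorm y))) ≤ p x y
  integral_eq_one : ∀ x, ∫ y, p x y = 1
  moment : ∃ B, 0 ≤ B ∧ ∀ x, ∫ y, p x y * sqNorm y ≤ B * (1 + sqNorm x)
  dominated : ∀ R : ℝ, ∃ c b : ℝ, 0 < b ∧
    ∀ x, sqNorm x ≤ R → ∀ y, p x y ≤ c * Real.exp (-(b * sqNorm y))
  spread : ∃ c s : ℝ, 0 < c ∧ 0 < s ∧
    ∀ x, c * Real.log (1 + s * sqNorm x) ≤ ∫ y, p x y * Real.log (1 + sqNorm y)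

/-- A positive measurable function on `ℂᴹ` whose logarithm grows at most quadratically. -/
structure TameDensity {M : ℕ} (q : (Fin M → ℂ) → ℝ) : Prop where
  measurable : Measurable q
  pos : ∀ y, 0 < q y
  abs_log_le : ∃ A, 0 ≤ A ∧ ∀ y, |Real.log (q y)| ≤ A * (1 + sqNorm y)

/-- The Kullback-Leibler divergence of `p x` from the density `q`, as a function of `x`. The total
mass of `q` may differ from `1`. -/
def divergence {N M : ℕ} (p : (Fin N → ℂ) → (Fin M → ℂ) → ℝ) (q : (Fin M → ℂ) → ℝ)
    (x : Fin N → ℂ) : ℝ :=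
  ∫ y, p x y * Real.log (p x y / q y)

/-- The density of the output when the input has distribution `μ`. -/
def outputDensity {N M : ℕ} (p : (Fin N → ℂ) → (Fin M → ℂ) → ℝ) (μ : Measure (Fin N → ℂ))
    (y : Fin M → ℂ) : ℝ :=
  ∫ x, p x y ∂μ

lemma tameDensity_of_bounds {M : ℕ} {q : (Fin M → ℂ) → ℝ} (hm : Measurable q) {c A : ℝ}
    (hc : ∀ y, q y ≤ c) (hA : ∀ y, Real.exp (-(A * (1 + sqNorm y))) ≤ q y) : TameDensity q := by
  have hpos : ∀ y, 0 < q y := fun y => (Real.exp_pos _).trans_le (hA y)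
  refine ⟨hm, hpos, max |Real.log c| |A|, le_max_of_le_left (abs_nonneg _), fun y => ?_⟩
  have h0 := sqNorm_nonneg y
  have hl : -(A * (1 + sqNorm y)) ≤ Real.log (q y) := (Real.le_log_iff_exp_le (hpos y)).2 (hA y)
  have hu : Real.log (q y) ≤ Real.log c := Real.log_le_log (hpos y) (hc y)
  have h1 : |Real.log c| ≤ max |Real.log c| |A| := le_max_left _ _
  have h2 : A ≤ max |Real.log c| |A| := (le_abs_self A).trans (le_max_right _ _)
  have h3 := le_abs_self (Real.log c)
  have h4 := abs_nonneg (Real.log c)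
  rw [abs_le]
  constructor <;> nlinarith

/-- Gibbs' inequality for densities that need not be normalized. -/
lemma integral_sub_integral_le {M : ℕ} {f q : (Fin M → ℂ) → ℝ}
    (hf : ∀ y, 0 < f y) (hq : ∀ y, 0 < q y) (hfi : Integrable f) (hqi : Integrable q)
    (hfq : Integrable fun y => f y * Real.log (f y / q y)) :
    (∫ y, f y) - ∫ y, q y ≤ ∫ y, f y * Real.log (f y / q y) := by
  rw [← integral_sub hfi hqi]
  refine integral_mono (hfi.sub hqi) hfq fun y => ?_
  have := Real.one_sub_inv_le_log_of_pos (div_pos (hf y) (hq y))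
  calc f y - q y = f y * (1 - (f y / q y)⁻¹) := by
        have := (hf y).ne'
        have := (hq y).ne'
        field_simp
    _ ≤ _ := mul_le_mul_of_nonneg_left this (hf y).le

lemma TameDensity.log_div {M : ℕ} {q r : (Fin M → ℂ) → ℝ}
    (hq : TameDensity q) (hr : TameDensity r) :
    ∃ A, 0 ≤ A ∧ ∀ y, |Real.log (r y / q y)| ≤ A * (1 + sqNorm y) := by
  obtain ⟨A, hA0, hA⟩ := hq.abs_log_le
  obtain ⟨A', hA0', hA'⟩ := hr.abs_log_le
  refine ⟨A + A', by positivity, fun y => ?_⟩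
  rw [Real.log_div (hr.pos y).ne' (hq.pos y).ne']
  have := (abs_sub (Real.log (r y)) (Real.log (q y))).trans (add_le_add (hA' y) (hA y))
  linarith

namespace TameKernel

variable {N M : ℕ} {p : (Fin N → ℂ) → (Fin M → ℂ) → ℝ}

lemma pos (hp : TameKernel p) (x : Fin N → ℂ) (y : Fin M → ℂ) : 0 < p x y := by
  obtain ⟨A, -, hA⟩ := hp.lower
  exact (Real.exp_pos _).trans_le (hA x y)

lemma continuous_right (hp : TameKernel p) (x : Fin N → ℂ) : Continuous (p x) :=
  hp.continuous.comp (by fun_prop : Continuous fun y : Fin M → ℂ => (x, y))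

lemma continuous_left (hp : TameKernel p) (y : Fin M → ℂ) : Continuous fun x => p x y :=
  hp.continuous.comp (by fun_prop : Continuous fun x : Fin N → ℂ => (x, y))

lemma abs_log_le (hp : TameKernel p) :
    ∃ A, 0 ≤ A ∧ ∀ x y, |Real.log (p x y)| ≤ A * (1 + sqNorm x + sqNorm y) := by
  obtain ⟨A, hA0, hA⟩ := hp.lower
  obtain ⟨c, hc1, hc⟩ := hp.bounded
  refine ⟨A + Real.log c, add_nonneg hA0 (Real.log_nonneg hc1), fun x y => ?_⟩
  have hl := (Real.le_log_iff_exp_le (hp.pos x y)).2 (hA x y)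
  have hu := Real.log_le_log (hp.pos x y) (hc x y)
  have h0 := Real.log_nonneg hc1
  have h1 := sqNorm_nonneg x
  have h2 := sqNorm_nonneg y
  have h3 : 0 ≤ A * (1 + sqNorm x + sqNorm y) := by positivity
  have h4 : Real.log c ≤ Real.log c * (1 + sqNorm x + sqNorm y) := by nlinarith
  rw [abs_le]
  constructor <;> nlinarith

lemma integrable_mul (hp : TameKernel p) (x : Fin N → ℂ) {ψ : (Fin M → ℂ) → ℝ}
    (hψ : AEStronglyMeasurable ψ) {A : ℝ} (hA : ∀ y, |ψ y| ≤ A * (1 + sqNorm y)) :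
    Integrable fun y => p x y * ψ y := by
  obtain ⟨c, b, hb, h⟩ := hp.dominated (sqNorm x)
  refine Integrable.mono' ((integrable_one_add_sqNorm_mul_exp (n := M) hb).const_mul (c * A))
    ((hp.continuous_right x).aestronglyMeasurable.mul hψ) (ae_of_all _ fun y => ?_)
  rw [Real.norm_eq_abs, abs_mul, abs_of_pos (hp.pos x y)]
  calc p x y * |ψ y| ≤ (c * Real.exp (-(b * sqNorm y))) * (A * (1 + sqNorm y)) :=
        mul_le_mul (h x le_rfl y) (hA y) (abs_nonneg _) ((hp.pos x y).le.trans (h x le_rfl y))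
    _ = _ := by ring

lemma integrable (hp : TameKernel p) (x : Fin N → ℂ) : Integrable (p x) := by
  simpa using hp.integrable_mul x (ψ := fun _ => 1) aestronglyMeasurable_const (A := 1)
    (fun y => by simpa using sqNorm_nonneg y)

lemma integrable_mul_sqNorm (hp : TameKernel p) (x : Fin N → ℂ) :
    Integrable fun y => p x y * sqNorm y :=
  hp.integrable_mul x continuous_sqNorm.aestronglyMeasurable (A := 1) fun y => by
    rw [abs_of_nonneg (sqNorm_nonneg y)]; linarith

/-- Expectations under `p x` of functions of quadratic growth in `y` grow quadratically in `x`. -/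
lemma integral_mul_le (hp : TameKernel p) {B : ℝ}
    (hB : ∀ x, ∫ y, p x y * sqNorm y ≤ B * (1 + sqNorm x)) (x : Fin N → ℂ)
    {ψ : (Fin M → ℂ) → ℝ} (hψ : Integrable fun y => p x y * ψ y) {a δ : ℝ} (hδ : 0 ≤ δ)
    (h : ∀ y, ψ y ≤ a + δ * sqNorm y) :
    ∫ y, p x y * ψ y ≤ a + δ * (B * (1 + sqNorm x)) := by
  have h1 : ∫ y, p x y * ψ y ≤ ∫ y, (a * p x y + δ * (p x y * sqNorm y)) := by
    refine integral_mono hψ (((hp.integrable x).const_mul a).add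
      ((hp.integrable_mul_sqNorm x).const_mul δ)) fun y => ?_
    have := mul_le_mul_of_nonneg_left (h y) (hp.pos x y).le
    dsimp only
    linarith
  rw [integral_add ((hp.integrable x).const_mul a) ((hp.integrable_mul_sqNorm x).const_mul δ),
    integral_const_mul, integral_const_mul, hp.integral_eq_one] at h1
  have := mul_le_mul_of_nonneg_left (hB x) hδ
  linarith

/-! ### Divergence from a tame density -/

lemma abs_log_div_le (hp : TameKernel p) {q : (Fin M → ℂ) → ℝ} (hq : TameDensity q) :
    ∃ A, 0 ≤ A ∧ ∀ x y, |Real.log (p x y / q y)| ≤ A * (1 + sqNorm x + sqNorm y) := by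
  obtain ⟨A, hA0, hA⟩ := hp.abs_log_le
  obtain ⟨A', hA0', hA'⟩ := hq.abs_log_le
  refine ⟨A + A', by positivity, fun x y => ?_⟩
  rw [Real.log_div (hp.pos x y).ne' (hq.pos y).ne']
  have h1 := sqNorm_nonneg x
  have h2 := (abs_sub (Real.log (p x y)) (Real.log (q y))).trans (add_le_add (hA x y) (hA' y))
  nlinarith

lemma aestronglyMeasurable_log_div (hp : TameKernel p) {q : (Fin M → ℂ) → ℝ}
    (hq : TameDensity q) (x : Fin N → ℂ) :
    AEStronglyMeasurable fun y => Real.log (p x y / q y) :=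
  (Real.measurable_log.comp
    ((hp.continuous_right x).measurable.div hq.measurable)).aestronglyMeasurable

lemma integrable_mul_log_div (hp : TameKernel p) {q : (Fin M → ℂ) → ℝ} (hq : TameDensity q)
    (x : Fin N → ℂ) : Integrable fun y => p x y * Real.log (p x y / q y) := by
  obtain ⟨A, hA0, hA⟩ := hp.abs_log_div_le hq
  refine hp.integrable_mul x (hp.aestronglyMeasurable_log_div hq x) (A := A * (1 + sqNorm x))
    fun y => (hA x y).trans ?_
  have h1 := sqNorm_nonneg x
  have h2 := sqNorm_nonneg y
  nlinarith [mul_nonneg hA0 (mul_nonneg h1 h2)]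

lemma abs_divergence_le (hp : TameKernel p) {q : (Fin M → ℂ) → ℝ} (hq : TameDensity q) :
    ∃ A, 0 ≤ A ∧ ∀ x, |divergence p q x| ≤ A * (1 + sqNorm x) := by
  obtain ⟨A, hA0, hA⟩ := hp.abs_log_div_le hq
  obtain ⟨B, hB0, hB⟩ := hp.moment
  refine ⟨A * (1 + B), by positivity, fun x => ?_⟩
  have h : ∫ y, p x y * |Real.log (p x y / q y)|
      ≤ A * (1 + sqNorm x) + A * (B * (1 + sqNorm x)) := by
    refine hp.integral_mul_le hB x ?_ hA0 fun y => (hA x y).trans (by linarith)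
    have := (hp.integrable_mul_log_div hq x).abs
    simpa only [abs_mul, abs_of_pos (hp.pos x _)] using this
  calc |divergence p q x| ≤ ∫ y, |p x y * Real.log (p x y / q y)| := abs_integral_le_integral_abs
    _ = ∫ y, p x y * |Real.log (p x y / q y)| := by simp only [abs_mul, abs_of_pos (hp.pos x _)]
    _ ≤ _ := by linarith

lemma continuous_divergence (hp : TameKernel p) {q : (Fin M → ℂ) → ℝ} (hq : TameDensity q) :
    Continuous (divergence p q) := by
  obtain ⟨A, hA0, hA⟩ := hp.abs_log_div_le hq
  rw [continuous_iff_continuousAt]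
  intro x₀
  obtain ⟨c, b, hb, h⟩ := hp.dominated (sqNorm x₀ + 1)
  have hR : ∀ᶠ x in 𝓝 x₀, sqNorm x < sqNorm x₀ + 1 :=
    continuous_sqNorm.continuousAt.eventually_lt_const (lt_add_one _)
  refine continuousAt_of_dominated (bound := fun y => (c * A * (2 + sqNorm x₀)) *
    ((1 + sqNorm y) * Real.exp (-(b * sqNorm y)))) (.of_forall fun x =>
      (hp.integrable_mul_log_div hq x).aestronglyMeasurable) ?_
      ((integrable_one_add_sqNorm_mul_exp hb).const_mul _) (ae_of_all _ fun y => ?_)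
  · filter_upwards [hR] with x hx
    refine ae_of_all _ fun y => ?_
    have h1 := sqNorm_nonneg x
    have h2 := sqNorm_nonneg y
    rw [Real.norm_eq_abs, abs_mul, abs_of_pos (hp.pos x y)]
    have h3 : |Real.log (p x y / q y)| ≤ A * ((2 + sqNorm x₀) * (1 + sqNorm y)) := by
      refine (hA x y).trans (mul_le_mul_of_nonneg_left ?_ hA0)
      nlinarith
    calc p x y * |Real.log (p x y / q y)|
        ≤ (c * Real.exp (-(b * sqNorm y))) * (A * ((2 + sqNorm x₀) * (1 + sqNorm y))) :=
          mul_le_mul (h x hx.le y) h3 (abs_nonneg _) ((hp.pos x y).le.trans (h x hx.le y))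
      _ = _ := by ring
  · have hc := hp.continuous_left y
    exact (hc.mul ((hc.div_const _).log fun x =>
      (div_pos (hp.pos x y) (hq.pos y)).ne')).continuousAt

lemma integrable_divergence (hp : TameKernel p) {q : (Fin M → ℂ) → ℝ} (hq : TameDensity q)
    {μ : Measure (Fin N → ℂ)} [IsProbabilityMeasure μ] (hμ : Integrable sqNorm μ) :
    Integrable (divergence p q) μ := by
  obtain ⟨A, hA0, hA⟩ := hp.abs_divergence_le hq
  exact Integrable.mono' (((integrable_const 1).add hμ).const_mul A)
    (hp.continuous_divergence hq).aestronglyMeasurable (ae_of_all _ hA)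

/-- Changing the reference density changes the divergence by an integral that is linear in
`p x`. -/
lemma divergence_sub_divergence (hp : TameKernel p) {q r : (Fin M → ℂ) → ℝ} (hq : TameDensity q)
    (hr : TameDensity r) (x : Fin N → ℂ) :
    divergence p q x - divergence p r x = ∫ y, p x y * Real.log (r y / q y) := by
  unfold divergence
  rw [← integral_sub (hp.integrable_mul_log_div hq x) (hp.integrable_mul_log_div hr x)]
  refine integral_congr_ae (ae_of_all _ fun y => ?_)
  dsimp only
  rw [Real.log_div (hp.pos x y).ne' (hq.pos y).ne', Real.log_div (hp.pos x y).ne' (hr.pos y).ne',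
    Real.log_div (hr.pos y).ne' (hq.pos y).ne']
  ring

lemma divergence_anti (hp : TameKernel p) {q r : (Fin M → ℂ) → ℝ} (hq : TameDensity q)
    (hr : TameDensity r) (h : ∀ y, q y ≤ r y) (x : Fin N → ℂ) :
    divergence p r x ≤ divergence p q x := by
  have := hp.divergence_sub_divergence hq hr x
  have h0 : 0 ≤ ∫ y, p x y * Real.log (r y / q y) := integral_nonneg fun y =>
    mul_nonneg (hp.pos x y).le (Real.log_nonneg ((one_le_div (hq.pos y)).2 (h y)))
  linarith

/-! ### The output density -/

lemma integrable_prod_mul (hp : TameKernel p) {μ : Measure (Fin N → ℂ)} [IsProbabilityMeasure μ]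
    (hμ : Integrable sqNorm μ) {ψ : (Fin M → ℂ) → ℝ} (hψ : Measurable ψ) {A : ℝ} (hA0 : 0 ≤ A)
    (hA : ∀ y, |ψ y| ≤ A * (1 + sqNorm y)) :
    Integrable (Function.uncurry fun x y => p x y * ψ y) (μ.prod volume) := by
  obtain ⟨B, hB0, hB⟩ := hp.moment
  have hm : StronglyMeasurable (Function.uncurry fun x y => p x y * ψ y) :=
    (hp.continuous.measurable.mul (hψ.comp measurable_snd)).stronglyMeasurable
  refine (integrable_prod_iff hm.aestronglyMeasurable).2 ⟨ae_of_all _ fun x =>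
    hp.integrable_mul x hψ.aestronglyMeasurable hA, ?_⟩
  refine Integrable.mono' (g := fun x => A + A * (B * (1 + sqNorm x)))
    ((integrable_const A).add ((((integrable_const 1).add hμ).const_mul B).const_mul A))
    (hm.norm.integral_prod_right').aestronglyMeasurable (ae_of_all _ fun x => ?_)
  rw [Real.norm_of_nonneg (integral_nonneg fun _ => norm_nonneg _)]
  simp only [Function.uncurry_apply_pair, Real.norm_eq_abs, abs_mul, abs_of_pos (hp.pos x _)]
  refine hp.integral_mul_le hB x ?_ hA0 fun y => (hA y).trans (by linarith)
  exact hp.integrable_mul x (continuous_abs.measurable.comp hψ).aestronglyMeasurable (A := A)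
    fun y => by simpa using hA y

/-- Expectations under the output distribution, by Fubini. -/
lemma integral_integral_mul (hp : TameKernel p) {μ : Measure (Fin N → ℂ)}
    [IsProbabilityMeasure μ] (hμ : Integrable sqNorm μ) {ψ : (Fin M → ℂ) → ℝ}
    (hψ : Measurable ψ) {A : ℝ} (hA0 : 0 ≤ A) (hA : ∀ y, |ψ y| ≤ A * (1 + sqNorm y)) :
    ∫ x, (∫ y, p x y * ψ y) ∂μ = ∫ y, outputDensity p μ y * ψ y := by
  rw [integral_integral_swap (hp.integrable_prod_mul hμ hψ hA0 hA)]
  simp only [outputDensity, integral_mul_const]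

lemma integrable_outputDensity_mul (hp : TameKernel p) {μ : Measure (Fin N → ℂ)}
    [IsProbabilityMeasure μ] (hμ : Integrable sqNorm μ) {ψ : (Fin M → ℂ) → ℝ}
    (hψ : Measurable ψ) {A : ℝ} (hA0 : 0 ≤ A) (hA : ∀ y, |ψ y| ≤ A * (1 + sqNorm y)) :
    Integrable fun y => outputDensity p μ y * ψ y := by
  have := (hp.integrable_prod_mul hμ hψ hA0 hA).integral_prod_right
  simpa only [Function.uncurry_apply_pair, integral_mul_const, outputDensity] using this

lemma integrable_outputDensity (hp : TameKernel p) {μ : Measure (Fin N → ℂ)}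
    [IsProbabilityMeasure μ] (hμ : Integrable sqNorm μ) : Integrable (outputDensity p μ) := by
  simpa using hp.integrable_outputDensity_mul hμ (ψ := fun _ => 1) measurable_const
    zero_le_one (fun y => by simpa using sqNorm_nonneg y)

lemma integral_outputDensity (hp : TameKernel p) {μ : Measure (Fin N → ℂ)}
    [IsProbabilityMeasure μ] (hμ : Integrable sqNorm μ) : ∫ y, outputDensity p μ y = 1 := by
  have := hp.integral_integral_mul hμ (ψ := fun _ => 1) measurable_const
    zero_le_one (fun y => by simpa using sqNorm_nonneg y)
  simp only [mul_one, hp.integral_eq_one, integral_const, probReal_univ, smul_eq_mul] at this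
  exact this.symm

lemma integrable_left (hp : TameKernel p) {μ : Measure (Fin N → ℂ)} [IsFiniteMeasure μ]
    (y : Fin M → ℂ) : Integrable (fun x => p x y) μ := by
  obtain ⟨c, hc1, hc⟩ := hp.bounded
  exact Integrable.mono' (integrable_const c) (hp.continuous_left y).aestronglyMeasurable
    (ae_of_all _ fun x => by rw [Real.norm_of_nonneg (hp.pos x y).le]; exact hc x y)

lemma outputDensity_bounds (hp : TameKernel p) {μ : Measure (Fin N → ℂ)}
    [IsProbabilityMeasure μ] : ∃ c A, 0 ≤ A ∧ (∀ y, outputDensity p μ y ≤ c) ∧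
      ∀ y, Real.exp (-(A * (1 + sqNorm y))) ≤ outputDensity p μ y := by
  obtain ⟨c, hc1, hc⟩ := hp.bounded
  obtain ⟨A, hA0, hA⟩ := hp.lower
  have hi : Integrable (fun x => Real.exp (-(A * (1 + sqNorm x)))) μ := by
    refine Integrable.mono' (integrable_const 1)
      (Continuous.aestronglyMeasurable (by unfold sqNorm; fun_prop))
      (ae_of_all _ fun x => ?_)
    rw [Real.norm_of_nonneg (Real.exp_pos _).le, Real.exp_le_one_iff]
    have := sqNorm_nonneg x
    have : 0 ≤ A * (1 + sqNorm x) := by positivity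
    linarith
  have hk := integral_exp_pos hi
  set k := ∫ x, Real.exp (-(A * (1 + sqNorm x))) ∂μ with hk_def
  refine ⟨c, A + |Real.log k|, by positivity, fun y => ?_, fun y => ?_⟩
  · calc outputDensity p μ y ≤ ∫ _, c ∂μ :=
          integral_mono (hp.integrable_left y) (integrable_const c) fun x => hc x y
      _ = c := by simp
  · have h0 := sqNorm_nonneg y
    have h1 : k * Real.exp (-(A * sqNorm y)) ≤ outputDensity p μ y := by
      rw [hk_def, ← integral_mul_const]
      refine integral_mono (hi.mul_const _) (hp.integrable_left y) fun x => ?_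
      dsimp only
      rw [← Real.exp_add]
      refine le_trans (Real.exp_le_exp.2 (le_of_eq ?_)) (hA x y)
      ring
    refine le_trans ?_ h1
    nth_rw 2 [← Real.exp_log hk]
    rw [← Real.exp_add, Real.exp_le_exp]
    have := neg_abs_le (Real.log k)
    nlinarith [abs_nonneg (Real.log k)]

lemma measurable_outputDensity (hp : TameKernel p) {μ : Measure (Fin N → ℂ)}
    [IsProbabilityMeasure μ] : Measurable (outputDensity p μ) :=
  (hp.continuous.measurable.stronglyMeasurable.integral_prod_left' (μ := μ)).measurable

lemma tameDensity_outputDensity (hp : TameKernel p) {μ : Measure (Fin N → ℂ)}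
    [IsProbabilityMeasure μ] : TameDensity (outputDensity p μ) := by
  obtain ⟨c, A, -, hc, hA⟩ := hp.outputDensity_bounds (μ := μ)
  exact tameDensity_of_bounds hp.measurable_outputDensity hc hA

lemma integral_divergence_sub (hp : TameKernel p) {μ : Measure (Fin N → ℂ)}
    [IsProbabilityMeasure μ] (hμ : Integrable sqNorm μ) {q r : (Fin M → ℂ) → ℝ}
    (hq : TameDensity q) (hr : TameDensity r) :
    (∫ x, divergence p q x ∂μ) - ∫ x, divergence p r x ∂μ
      = ∫ y, outputDensity p μ y * Real.log (r y / q y) := by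
  obtain ⟨A, hA0, hA⟩ := hq.log_div hr
  rw [← integral_sub (hp.integrable_divergence hq hμ) (hp.integrable_divergence hr hμ),
    ← hp.integral_integral_mul hμ (ψ := fun y => Real.log (r y / q y))
      (Real.measurable_log.comp (hr.measurable.div hq.measurable)) hA0 hA]
  exact integral_congr_ae (ae_of_all _ (hp.divergence_sub_divergence hq hr))

/-- Mutual information is the least mean divergence from a reference density `q`; when `q` is not
normalized its excess mass has to be added. -/
lemma integral_divergence_le (hp : TameKernel p) {μ : Measure (Fin N → ℂ)}
    [IsProbabilityMeasure μ] (hμ : Integrable sqNorm μ) {q : (Fin M → ℂ) → ℝ}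
    (hq : TameDensity q) (hqi : Integrable q) :
    ∫ x, divergence p (outputDensity p μ) x ∂μ
      ≤ (∫ x, divergence p q x ∂μ) + ((∫ y, q y) - 1) := by
  have hf := hp.tameDensity_outputDensity (μ := μ)
  obtain ⟨A, hA0, hA⟩ := hq.log_div hf
  have h1 := integral_sub_integral_le hf.pos hq.pos (hp.integrable_outputDensity hμ) hqi
    (hp.integrable_outputDensity_mul hμ (Real.measurable_log.comp
      (hf.measurable.div hq.measurable)) hA0 hA)
  rw [← hp.integral_divergence_sub hμ hq hf, hp.integral_outputDensity hμ] at h1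
  linarith

end TameKernel

/-! ### Input distributions of bounded power -/

lemma power_eq {N : ℕ} (x : Fin N → ℂ) : power x = (1 / (N : ℝ)) * sqNorm x := rfl

lemma sqNorm_eq {N : ℕ} (hN : 1 ≤ N) (x : Fin N → ℂ) : sqNorm x = N * power x := by
  have : (N : ℝ) ≠ 0 := by positivity
  rw [power_eq]
  field_simp

lemma power_nonneg {N : ℕ} (x : Fin N → ℂ) : 0 ≤ power x := by
  rw [power_eq]
  exact mul_nonneg (by positivity) (sqNorm_nonneg x)

lemma continuous_power {N : ℕ} : Continuous (power : (Fin N → ℂ) → ℝ) :=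
  continuous_const.mul continuous_sqNorm

lemma integrable_sqNorm_of_mem_inputs {N : ℕ} (hN : 1 ≤ N) {a : ℝ} {μ : Measure (Fin N → ℂ)}
    (hμ : μ ∈ inputs N a) : Integrable sqNorm μ := by
  have : (sqNorm : (Fin N → ℂ) → ℝ) = fun x => N * power x := funext (sqNorm_eq hN)
  rw [this]
  exact hμ.2.1.const_mul _

lemma integral_sqNorm_le_of_mem_inputs {N : ℕ} (hN : 1 ≤ N) {a : ℝ} {μ : Measure (Fin N → ℂ)}
    (hμ : μ ∈ inputs N a) : ∫ x, sqNorm x ∂μ ≤ N * a := by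
  simp_rw [sqNorm_eq hN, integral_const_mul]
  exact mul_le_mul_of_nonneg_left hμ.2.2 (by positivity)

lemma isCompact_setOf_power_le {N : ℕ} (hN : 1 ≤ N) (r : ℝ) :
    IsCompact {x : Fin N → ℂ | power x ≤ r} := by
  refine Metric.isCompact_of_isClosed_isBounded (isClosed_le continuous_power continuous_const) ?_
  refine (Metric.isBounded_closedBall (x := (0 : Fin N → ℂ)) (r := Real.sqrt (N * r))).subset ?_
  intro x (hx : power x ≤ r)
  rw [mem_closedBall_zero_iff, pi_norm_le_iff_of_nonneg (Real.sqrt_nonneg _)]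
  intro i
  refine Real.le_sqrt_of_sq_le ?_
  have h1 : ‖x i‖ ^ 2 ≤ sqNorm x :=
    Finset.single_le_sum (f := fun j => ‖x j‖ ^ 2) (fun _ _ => sq_nonneg _) (Finset.mem_univ i)
  rw [sqNorm_eq hN] at h1
  exact h1.trans (mul_le_mul_of_nonneg_left hx (by positivity))

/-- The power truncated at level `k`, as a bounded continuous function. -/
def truncPower (N k : ℕ) : BoundedContinuousFunction (Fin N → ℂ) ℝ :=
  BoundedContinuousFunction.ofNormedAddCommGroup (fun x => min (power x) k)
    (continuous_power.min continuous_const) k fun x => by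
      rw [Real.norm_of_nonneg (le_min (power_nonneg x) (by positivity))]
      exact min_le_right _ _

/-- The power constraint, which involves an unbounded function, is equivalent to constraints on
bounded continuous functions and hence closed under weak convergence. -/
lemma mem_inputs_iff {N : ℕ} {a : ℝ} (ν : ProbabilityMeasure (Fin N → ℂ)) :
    (ν : Measure (Fin N → ℂ)) ∈ inputs N a ↔
      ∀ k : ℕ, ∫ x, truncPower N k x ∂(ν : Measure (Fin N → ℂ)) ≤ a := by
  constructor
  · intro h k
    refine (integral_mono ((truncPower N k).integrable _) h.2.1 fun x => ?_).trans h.2.2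
    exact min_le_left _ _
  · intro h
    have ha : 0 ≤ a := (integral_nonneg fun x =>
      le_min (power_nonneg x) (by positivity)).trans (h 0)
    have hlim : Tendsto (fun k : ℕ => ∫⁻ x, ENNReal.ofReal (truncPower N k x)
        ∂(ν : Measure (Fin N → ℂ))) atTop
        (𝓝 (∫⁻ x, ENNReal.ofReal (power x) ∂(ν : Measure (Fin N → ℂ)))) := by
      refine lintegral_tendsto_of_tendsto_of_monotone (fun k => ?_) (ae_of_all _ fun x => ?_)
        (ae_of_all _ fun x => ?_)
      · exact (ENNReal.measurable_ofReal.comp (truncPower N k).continuous.measurable).aemeasurable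
      · intro k l hkl
        exact ENNReal.ofReal_le_ofReal (min_le_min_left _ (by exact_mod_cast hkl))
      · refine tendsto_const_nhds.congr' ?_
        obtain ⟨k₀, hk₀⟩ := exists_nat_ge (power x)
        filter_upwards [eventually_ge_atTop k₀] with k hk
        congr 1
        exact (min_eq_left (hk₀.trans (by exact_mod_cast hk))).symm
    have hle : ∫⁻ x, ENNReal.ofReal (power x) ∂(ν : Measure (Fin N → ℂ)) ≤ ENNReal.ofReal a := by
      refine le_of_tendsto hlim (.of_forall fun k => ?_)
      rw [← ofReal_integral_eq_lintegral_ofReal ((truncPower N k).integrable _)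
        (ae_of_all _ fun x => le_min (power_nonneg x) (by positivity))]
      exact ENNReal.ofReal_le_ofReal (h k)
    have hi : Integrable power (ν : Measure (Fin N → ℂ)) := by
      refine ⟨continuous_power.aestronglyMeasurable, ?_⟩
      rw [hasFiniteIntegral_iff_ofReal (ae_of_all _ power_nonneg)]
      exact hle.trans_lt ENNReal.ofReal_lt_top
    refine ⟨inferInstance, hi, ?_⟩
    rw [← ENNReal.ofReal_le_ofReal_iff ha,
      ofReal_integral_eq_lintegral_ofReal hi (ae_of_all _ power_nonneg)]
    exact hle

/-- The admissible input distributions form a weakly compact set, by Prokhorov's theorem. -/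
lemma isCompact_inputs {N : ℕ} (hN : 1 ≤ N) {a : ℝ} (ha : 0 < a) :
    IsCompact {ν : ProbabilityMeasure (Fin N → ℂ) | (ν : Measure (Fin N → ℂ)) ∈ inputs N a} := by
  have hclosed :
      IsClosed {ν : ProbabilityMeasure (Fin N → ℂ) | (ν : Measure (Fin N → ℂ)) ∈ inputs N a} := by
    simp_rw [mem_inputs_iff, Set.ofPred_forall]
    exact isClosed_iInter fun k => isClosed_le
      (ProbabilityMeasure.continuous_integral_boundedContinuousFunction _) continuous_const
  rw [← hclosed.closure_eq]
  refine isCompact_closure_of_isTightMeasureSet ?_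
  rw [isTightMeasureSet_iff_exists_isCompact_measure_compl_le]
  intro ε hε
  obtain ⟨e, he0, heε⟩ : ∃ e : ℝ, 0 < e ∧ ENNReal.ofReal e ≤ ε := by
    rcases eq_or_ne ε ⊤ with rfl | h
    · exact ⟨1, one_pos, le_top⟩
    · exact ⟨ε.toReal, ENNReal.toReal_pos hε.ne' h, ENNReal.ofReal_toReal_le⟩
  refine ⟨{x | power x ≤ a / e}, isCompact_setOf_power_le hN _, ?_⟩
  rintro _ ⟨ν, hν, rfl⟩
  have hν : (ν : Measure (Fin N → ℂ)) ∈ inputs N a := hν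
  have h1 := mul_meas_ge_le_integral_of_nonneg (ae_of_all _ power_nonneg) hν.2.1 (a / e)
  have h2 : (ν : Measure (Fin N → ℂ)).real {x | a / e ≤ power x} ≤ e := by
    have h3 := h1.trans hν.2.2
    rw [div_mul_eq_mul_div, div_le_iff₀ he0] at h3
    exact le_of_mul_le_mul_left h3 ha
  calc (ν : Measure (Fin N → ℂ)) {x | power x ≤ a / e}ᶜ
      ≤ (ν : Measure (Fin N → ℂ)) {x | a / e ≤ power x} := by
        refine measure_mono fun x hx => ?_
        simp only [Set.mem_compl_iff, Set.mem_ofPred_eq, not_le] at hx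
        exact hx.le
    _ = ENNReal.ofReal ((ν : Measure (Fin N → ℂ)).real {x | a / e ≤ power x}) := by simp
    _ ≤ ENNReal.ofReal e := ENNReal.ofReal_le_ofReal h2
    _ ≤ ε := heε

/-- A continuous function that is bounded above is the decreasing limit of its truncations from
below, so that its integral is upper semicontinuous under weak convergence. -/
lemma eventually_integral_lt {X : Type*} [TopologicalSpace X] [MeasurableSpace X]
    [OpensMeasurableSpace X] {g : X → ℝ} (hg : Continuous g) {c : ℝ} (hc : ∀ x, g x ≤ c)
    (μ : ProbabilityMeasure X) (hμ : Integrable g (μ : Measure X)) {r : ℝ}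
    (hr : ∫ x, g x ∂(μ : Measure X) < r) :
    ∀ᶠ ν : ProbabilityMeasure X in 𝓝 μ,
      Integrable g (ν : Measure X) → ∫ x, g x ∂(ν : Measure X) < r := by
  have hlim : Tendsto (fun k : ℕ => ∫ x, max (g x) (-k) ∂(μ : Measure X)) atTop
      (𝓝 (∫ x, g x ∂(μ : Measure X))) := by
    refine tendsto_integral_of_dominated_convergence (fun x => |g x|)
      (fun k => (hg.measurable.max measurable_const).aestronglyMeasurable) hμ.abs
      (fun k => ae_of_all _ fun x => ?_) (ae_of_all _ fun x => ?_)
    · rw [Real.norm_eq_abs, abs_le]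
      have h1 := neg_abs_le (g x)
      have h2 := le_abs_self (g x)
      have h3 : (0 : ℝ) ≤ k := by positivity
      exact ⟨h1.trans (le_max_left _ _), max_le h2 (by linarith [abs_nonneg (g x)])⟩
    · refine tendsto_const_nhds.congr' ?_
      obtain ⟨k₀, hk₀⟩ := exists_nat_ge (-g x)
      filter_upwards [eventually_ge_atTop k₀] with k hk
      have : (k₀ : ℝ) ≤ k := by exact_mod_cast hk
      exact (max_eq_left (by linarith)).symm
  obtain ⟨k, hk⟩ := (hlim.eventually_lt_const hr).exists
  let gk : BoundedContinuousFunction X ℝ :=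
    BoundedContinuousFunction.ofNormedAddCommGroup (fun x => max (g x) (-k))
      (hg.max continuous_const) (max |c| k) fun x => by
        rw [Real.norm_eq_abs, abs_le]
        have h3 : (0 : ℝ) ≤ k := by positivity
        refine ⟨le_max_of_le_right (neg_le_neg (le_max_right _ _)), max_le ?_ ?_⟩
        · exact ((hc x).trans (le_abs_self c)).trans (le_max_left _ _)
        · exact le_max_of_le_right (by linarith)
  have hk' := (ProbabilityMeasure.continuous_integral_boundedContinuousFunction
    gk).continuousAt.eventually_lt_const (show ∫ x, gk x ∂(μ : Measure X) < r from hk)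
  filter_upwards [hk'] with ν hν hi
  exact (integral_mono hi (gk.integrable _) fun x => le_max_left _ _).trans_lt hν

/-! ### Mixtures of input distributions -/

lemma dirac_mem_inputs {N : ℕ} {a : ℝ} {x : Fin N → ℂ} (hx : power x ≤ a) :
    Measure.dirac x ∈ inputs N a :=
  ⟨inferInstance, integrable_dirac (by simp), by simpa using hx⟩

/-- The convex combination of two measures with weights `1 - t` and `t`. -/
def mix {X : Type*} [MeasurableSpace X] (t : ℝ) (μ ν : Measure X) :
    Measure X :=
  ENNReal.ofReal (1 - t) • μ + ENNReal.ofReal t • ν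

lemma isProbabilityMeasure_mix {X : Type*} [MeasurableSpace X] {t : ℝ}
    (h0 : 0 ≤ t) (h1 : t ≤ 1) (μ ν : Measure X) [IsProbabilityMeasure μ]
    [IsProbabilityMeasure ν] : IsProbabilityMeasure (mix t μ ν) := by
  constructor
  simp [mix, ← ENNReal.ofReal_add (sub_nonneg.2 h1) h0]

lemma integrable_mix {X : Type*} [MeasurableSpace X] {t : ℝ}
    {μ ν : Measure X} {g : X → ℝ} (hμ : Integrable g μ) (hν : Integrable g ν) :
    Integrable g (mix t μ ν) :=
  (hμ.smul_measure ENNReal.ofReal_ne_top).add_measure (hν.smul_measure ENNReal.ofReal_ne_top)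

lemma integral_mix {X : Type*} [MeasurableSpace X] {t : ℝ}
    (h0 : 0 ≤ t) (h1 : t ≤ 1) {μ ν : Measure X} {g : X → ℝ} (hμ : Integrable g μ)
    (hν : Integrable g ν) :
    ∫ x, g x ∂(mix t μ ν) = (1 - t) * ∫ x, g x ∂μ + t * ∫ x, g x ∂ν := by
  rw [mix, integral_add_measure (hμ.smul_measure ENNReal.ofReal_ne_top)
    (hν.smul_measure ENNReal.ofReal_ne_top), integral_smul_measure, integral_smul_measure,
    ENNReal.toReal_ofReal (sub_nonneg.2 h1), ENNReal.toReal_ofReal h0, smul_eq_mul, smul_eq_mul]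

lemma mix_mem_inputs {N : ℕ} {a t : ℝ} (h0 : 0 ≤ t) (h1 : t ≤ 1)
    {μ ν : Measure (Fin N → ℂ)} [IsProbabilityMeasure μ] [IsProbabilityMeasure ν]
    (hμ : Integrable power μ) (hν : Integrable power ν)
    (h : (1 - t) * ∫ x, power x ∂μ + t * ∫ x, power x ∂ν ≤ a) : mix t μ ν ∈ inputs N a :=
  ⟨isProbabilityMeasure_mix h0 h1 μ ν, integrable_mix hμ hν, by
    rwa [integral_mix h0 h1 hμ hν]⟩

/-! ### Convex combinations and supporting lines -/

lemma abs_log_convexComb_le {u v t : ℝ} (hu : 0 < u) (hv : 0 < v)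
    (h0 : 0 ≤ t) (h1 : t ≤ 1) :
    |Real.log ((1 - t) * u + t * v)| ≤ |Real.log u| + |Real.log v| := by
  have hmin : min u v ≤ (1 - t) * u + t * v := by
    nlinarith [min_le_left u v, min_le_right u v]
  have hmax : (1 - t) * u + t * v ≤ max u v := by
    nlinarith [le_max_left u v, le_max_right u v]
  have hm0 := lt_min hu hv
  have hl := Real.log_le_log hm0 hmin
  have hr := Real.log_le_log (hm0.trans_le hmin) hmax
  have a1 := abs_nonneg (Real.log u)
  have a2 := abs_nonneg (Real.log v)
  rw [abs_le]
  constructor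
  · refine le_trans ?_ hl
    rcases min_choice u v with h | h <;> rw [h]
    · linarith [neg_abs_le (Real.log u)]
    · linarith [neg_abs_le (Real.log v)]
  · refine hr.trans ?_
    rcases max_choice u v with h | h <;> rw [h]
    · linarith [le_abs_self (Real.log u)]
    · linarith [le_abs_self (Real.log v)]

/-- Lagrange duality for the linear programme of maximizing the mean of `i` under a bound `a` on
the mean of `P`: if no point and no mixture of two points has value above `C`, then the graph of
`i` over `P` lies below a line of nonnegative slope through `(a, C)`. -/
lemma exists_multiplier {X : Type*} {P i : X → ℝ} {a C : ℝ} {x₀ : X}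
    (h₀ : P x₀ < a) (h₁ : ∀ x, P x ≤ a → i x ≤ C)
    (h₂ : ∀ x₁ x₂ t, 0 ≤ t → t ≤ 1 → (1 - t) * P x₁ + t * P x₂ ≤ a →
      (1 - t) * i x₁ + t * i x₂ ≤ C) :
    ∃ γ, 0 ≤ γ ∧ ∀ x, i x ≤ γ * (P x - a) + C := by
  -- The weight `t = (a - P x₁) / (P x₂ - P x₁)` puts the mixture of `x₁` and `x₂` at `P = a`.
  have hslope : ∀ x₁ x₂, P x₁ < a → a < P x₂ →
      (i x₂ - C) / (P x₂ - a) ≤ (C - i x₁) / (a - P x₁) := by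
    intro x₁ x₂ hx₁ hx₂
    have hd : 0 < P x₂ - P x₁ := by linarith
    have h := h₂ x₁ x₂ ((a - P x₁) / (P x₂ - P x₁)) (div_nonneg (by linarith) hd.le)
      ((div_le_one hd).2 (by linarith)) (le_of_eq (by field_simp; ring))
    rw [div_le_div_iff₀ (by linarith) (by linarith)]
    have h' : (P x₂ - P x₁) * ((1 - (a - P x₁) / (P x₂ - P x₁)) * i x₁
        + (a - P x₁) / (P x₂ - P x₁) * i x₂) ≤ (P x₂ - P x₁) * C :=
      mul_le_mul_of_nonneg_left h hd.le
    have h'' : (P x₂ - P x₁) * ((1 - (a - P x₁) / (P x₂ - P x₁)) * i x₁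
        + (a - P x₁) / (P x₂ - P x₁) * i x₂) = (P x₂ - a) * i x₁ + (a - P x₁) * i x₂ := by
      field_simp
      ring
    rw [h''] at h'
    linarith
  -- `γ` is the largest slope towards a point beyond `a`; adjoining `0` makes it nonnegative.
  set T : Set ℝ := insert 0 {s | ∃ x, a < P x ∧ s = (i x - C) / (P x - a)} with hT
  have hub : ∀ x₁, P x₁ < a → ∀ s ∈ T, s ≤ (C - i x₁) / (a - P x₁) := by
    rintro x₁ hx₁ s (rfl | ⟨x, hx, rfl⟩)
    · exact div_nonneg (by linarith [h₁ x₁ hx₁.le]) (by linarith)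
    · exact hslope x₁ x hx₁ hx
  have hbdd : BddAbove T := ⟨_, hub x₀ h₀⟩
  refine ⟨sSup T, le_csSup hbdd (Set.mem_insert _ _), fun x => ?_⟩
  rcases lt_trichotomy (P x) a with hx | hx | hx
  · have := csSup_le ⟨0, Set.mem_insert _ _⟩ (hub x hx)
    rw [le_div_iff₀ (by linarith)] at this
    linarith
  · rw [hx, sub_self, mul_zero, zero_add]
    exact h₁ x hx.le
  · have := le_csSup hbdd (Set.mem_insert_of_mem _ ⟨x, hx, rfl⟩)
    rw [div_le_iff₀ (by linarith)] at this
    linarith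

/-! ### The capacity is attained -/

/-- The mutual information of a kernel for the input distribution `μ`. -/
def mutualInformation {N M : ℕ} (p : (Fin N → ℂ) → (Fin M → ℂ) → ℝ) (μ : Measure (Fin N → ℂ)) :
    ℝ :=
  ∫ x, divergence p (outputDensity p μ) x ∂μ

namespace TameKernel

variable {N M : ℕ} {p : (Fin N → ℂ) → (Fin M → ℂ) → ℝ}

/-- A density that decays no faster than a wide Gaussian keeps the divergence of `p x` below a
quadratic function of `x` with small leading coefficient. -/
lemma divergence_le_of_gaussian_le (hp : TameKernel p) {B : ℝ}
    (hB : ∀ x, ∫ y, p x y * sqNorm y ≤ B * (1 + sqNorm x)) {q : (Fin M → ℂ) → ℝ}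
    (hq : TameDensity q) {ε δ : ℝ} (hε : 0 < ε) (hδ : 0 ≤ δ)
    (h : ∀ y, ε * Real.exp (-(δ * sqNorm y)) ≤ q y) :
    ∃ a, ∀ x, divergence p q x ≤ a + δ * (B * (1 + sqNorm x)) := by
  obtain ⟨c, hc1, hc⟩ := hp.bounded
  refine ⟨Real.log c - Real.log ε, fun x => ?_⟩
  refine hp.integral_mul_le hB x (hp.integrable_mul_log_div hq x) hδ fun y => ?_
  have h1 := Real.log_le_log (by positivity) (h y)
  have h2 := Real.log_le_log (hp.pos x y) (hc x y)
  rw [Real.log_mul hε.ne' (Real.exp_pos _).ne', Real.log_exp] at h1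
  rw [Real.log_div (hp.pos x y).ne' (hq.pos y).ne']
  linarith

lemma upperSemicontinuousOn_mutualInformation (hp : TameKernel p) (hN : 1 ≤ N) {a : ℝ}
    (ha : 0 < a) :
    UpperSemicontinuousOn (fun ν : ProbabilityMeasure (Fin N → ℂ) =>
      mutualInformation p (ν : Measure (Fin N → ℂ)))
      {ν | (ν : Measure (Fin N → ℂ)) ∈ inputs N a} := by
  intro μ hμ r hr
  have hμ : (μ : Measure (Fin N → ℂ)) ∈ inputs N a := hμ
  obtain ⟨B, hB0, hB⟩ := hp.moment
  have hμs := integrable_sqNorm_of_mem_inputs hN hμ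
  set η := r - mutualInformation p (μ : Measure (Fin N → ℂ)) with hη
  have hη0 : 0 < η := sub_pos.2 hr
  -- The reference density is `f_μ` with a small amount of a wide Gaussian added: `δ` bounds the
  -- part of the divergence that weak convergence does not control, `ε` the excess mass.
  set δ := η / (4 * (1 + B * (N * a))) with hδ
  have hδ0 : 0 < δ := by positivity
  have hδB : δ * (B * (N * a)) ≤ η / 4 := by
    rw [hδ, div_mul_eq_mul_div, div_le_div_iff₀ (by positivity) (by positivity)]
    nlinarith [mul_nonneg hB0 (by positivity : (0 : ℝ) ≤ N * a)]
  set Z := ∫ y : Fin M → ℂ, Real.exp (-(δ * sqNorm y)) with hZ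
  have hZ0 : 0 < Z := by rw [hZ, integral_exp_neg_sqNorm hδ0]; positivity
  set ε := η / (4 * Z) with hε
  have hε0 : 0 < ε := by positivity
  have hεZ : ε * Z = η / 4 := by rw [hε]; field_simp
  have hf := hp.tameDensity_outputDensity (μ := (μ : Measure (Fin N → ℂ)))
  set f := outputDensity p (μ : Measure (Fin N → ℂ)) with hf_def
  set q : (Fin M → ℂ) → ℝ := fun y => f y + ε * Real.exp (-(δ * sqNorm y)) with hq_def
  have hG : Integrable fun y : Fin M → ℂ => ε * Real.exp (-(δ * sqNorm y)) :=
    (integrable_exp_neg_sqNorm hδ0).const_mul ε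
  have hq : TameDensity q := by
    obtain ⟨c, A, -, hc, hA⟩ := hp.outputDensity_bounds (μ := (μ : Measure (Fin N → ℂ)))
    refine tameDensity_of_bounds (c := c + ε) (A := A) (hf.measurable.add
      (Continuous.measurable (by unfold sqNorm; fun_prop))) (fun y => ?_) (fun y => ?_)
    · refine add_le_add (hc y) (mul_le_of_le_one_right hε0.le (Real.exp_le_one_iff.2 ?_))
      have := mul_nonneg hδ0.le (sqNorm_nonneg y)
      linarith
    · exact (hA y).trans (le_add_of_nonneg_right (by positivity))
  have hqi : Integrable q := (hp.integrable_outputDensity hμs).add hG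
  have hqm : (∫ y, q y) = 1 + η / 4 := by
    rw [hq_def, integral_add (hp.integrable_outputDensity hμs) hG,
      hp.integral_outputDensity hμs, integral_const_mul, hεZ]
  obtain ⟨b, hb⟩ := hp.divergence_le_of_gaussian_le hB hq hε0 hδ0.le
    fun y => le_add_of_nonneg_left (hf.pos y).le
  set g : (Fin N → ℂ) → ℝ := fun x => divergence p q x - δ * B * sqNorm x with hg_def
  have hgc : Continuous g :=
    (hp.continuous_divergence hq).sub (continuous_const.mul continuous_sqNorm)
  have hgi : ∀ ν : ProbabilityMeasure (Fin N → ℂ), (ν : Measure (Fin N → ℂ)) ∈ inputs N a →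
      Integrable g (ν : Measure (Fin N → ℂ)) := fun ν hν =>
    (hp.integrable_divergence hq (integrable_sqNorm_of_mem_inputs hN hν)).sub
      ((integrable_sqNorm_of_mem_inputs hN hν).const_mul _)
  have hgμ : ∫ x, g x ∂(μ : Measure (Fin N → ℂ)) ≤ mutualInformation p μ := by
    refine integral_mono (hgi μ hμ) (hp.integrable_divergence hf hμs) fun x => ?_
    have h1 := hp.divergence_anti hf hq (fun y => le_add_of_nonneg_right (by positivity)) x
    have h2 : 0 ≤ δ * B * sqNorm x := mul_nonneg (by positivity) (sqNorm_nonneg x)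
    simp only [hg_def]
    linarith
  have hev := eventually_integral_lt hgc (c := b + δ * B)
    (fun x => by have := hb x; simp only [hg_def]; linarith) μ (hgi μ hμ)
    (r := mutualInformation p μ + η / 4) (by linarith)
  filter_upwards [mem_nhdsWithin_of_mem_nhds hev, self_mem_nhdsWithin] with ν hν1 hν2
  have hν2 : (ν : Measure (Fin N → ℂ)) ∈ inputs N a := hν2
  have hνs := integrable_sqNorm_of_mem_inputs hN hν2
  have h1 := hν1 (hgi ν hν2)
  have h2 := hp.integral_divergence_le hνs hq hqi
  rw [hg_def, integral_sub (hp.integrable_divergence hq hνs) (hνs.const_mul _),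
    integral_const_mul] at h1
  have h3 := mul_le_mul_of_nonneg_left (integral_sqNorm_le_of_mem_inputs hN hν2)
    (mul_nonneg hδ0.le hB0)
  rw [hqm] at h2
  change mutualInformation p (ν : Measure (Fin N → ℂ)) ≤ _ at h2
  change mutualInformation p (ν : Measure (Fin N → ℂ)) < r
  linarith

lemma exists_isMaxOn_mutualInformation (hp : TameKernel p) (hN : 1 ≤ N) {a : ℝ} (ha : 0 < a) :
    ∃ μ ∈ inputs N a, IsMaxOn (mutualInformation p) (inputs N a) μ := by
  have h0 : (Measure.dirac (0 : Fin N → ℂ)) ∈ inputs N a :=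
    dirac_mem_inputs (by simp [power_eq, sqNorm, ha.le])
  obtain ⟨μ, hμ, hmax⟩ := UpperSemicontinuousOn.exists_isMaxOn
    (s := {ν : ProbabilityMeasure (Fin N → ℂ) | (ν : Measure (Fin N → ℂ)) ∈ inputs N a})
    ⟨⟨Measure.dirac 0, inferInstance⟩, h0⟩
    (isCompact_inputs hN ha) (hp.upperSemicontinuousOn_mutualInformation hN ha)
  exact ⟨μ, hμ, fun ν hν => hmax (a := ⟨ν, hν.1⟩) hν⟩

/-! ### The Karush-Kuhn-Tucker conditions -/

/-- First-order optimality: moving from an optimal `μ` towards an admissible `ν` does not increase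
the mutual information, and the derivative of the mutual information in this direction is the
difference of the two sides. -/
lemma integral_divergence_le_of_isMaxOn (hp : TameKernel p) (hN : 1 ≤ N) {a : ℝ}
    {μ ν : Measure (Fin N → ℂ)} (hμ : μ ∈ inputs N a) (hν : ν ∈ inputs N a)
    (hmax : IsMaxOn (mutualInformation p) (inputs N a) μ) :
    ∫ x, divergence p (outputDensity p μ) x ∂ν ≤ mutualInformation p μ := by
  have := hμ.1
  have := hν.1
  have hμs := integrable_sqNorm_of_mem_inputs hN hμ
  have hνs := integrable_sqNorm_of_mem_inputs hN hν
  have hf := hp.tameDensity_outputDensity (μ := μ)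
  have hg := hp.tameDensity_outputDensity (μ := ν)
  have hmixeq : ∀ t : ℝ, 0 ≤ t → t ≤ 1 → ∀ y, outputDensity p (mix t μ ν) y
      = (1 - t) * outputDensity p μ y + t * outputDensity p ν y := fun t h0 h1 y =>
    integral_mix h0 h1 (hp.integrable_left y) (hp.integrable_left y)
  -- Gibbs' inequality for `μ` with reference density `f_t = (1 - t) f_μ + t f_ν`, combined with the
  -- optimality of `μ`, bounds the mean of `D(x, f_t)` under `ν`.
  have key : ∀ t : ℝ, 0 < t → t < 1 → ∫ x, divergence p (outputDensity p μ) x ∂ν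
      ≤ mutualInformation p μ + ∫ y, outputDensity p ν y *
        Real.log (outputDensity p (mix t μ ν) y / outputDensity p μ y) := by
    intro t h0 h1
    have := isProbabilityMeasure_mix h0.le h1.le μ ν
    have hmem : mix t μ ν ∈ inputs N a := mix_mem_inputs h0.le h1.le hμ.2.1 hν.2.1 (by
      nlinarith [hμ.2.2, hν.2.2])
    have hms := integrable_sqNorm_of_mem_inputs hN hmem
    have ht := hp.tameDensity_outputDensity (μ := mix t μ ν)
    have e1 := hp.integral_divergence_sub hνs hf ht
    have e2 := hp.integral_divergence_le hμs ht (hp.integrable_outputDensity hms)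
    rw [hp.integral_outputDensity hms] at e2
    have e3 : mutualInformation p (mix t μ ν) ≤ mutualInformation p μ := hmax hmem
    rw [mutualInformation, integral_mix h0.le h1.le (hp.integrable_divergence ht hμs)
      (hp.integrable_divergence ht hνs)] at e3
    change mutualInformation p μ ≤ _ at e2
    have e4 : ∫ x, divergence p (outputDensity p (mix t μ ν)) x ∂ν ≤ mutualInformation p μ := by
      refine le_of_mul_le_mul_left ?_ h0
      nlinarith
    linarith
  have hlim : Tendsto (fun n : ℕ => ∫ y, outputDensity p ν y *
      Real.log (outputDensity p (mix (1 / ((n : ℝ) + 2)) μ ν) y / outputDensity p μ y)) atTop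
      (𝓝 (∫ y, outputDensity p ν y * 0)) := by
    obtain ⟨A, hA0, hA⟩ := hf.abs_log_le
    obtain ⟨A', hA0', hA'⟩ := hg.abs_log_le
    have ht0 : ∀ n : ℕ, 0 ≤ 1 / ((n : ℝ) + 2) := fun n => by positivity
    have ht1 : ∀ n : ℕ, 1 / ((n : ℝ) + 2) ≤ 1 := fun n => by
      rw [div_le_one (by positivity)]
      have : (0 : ℝ) ≤ n := by positivity
      linarith
    refine tendsto_integral_of_dominated_convergence
      (fun y => outputDensity p ν y * ((2 * A + A') * (1 + sqNorm y))) (fun n => ?_) ?_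
      (fun n => ae_of_all _ fun y => ?_) (ae_of_all _ fun y => ?_)
    · have := isProbabilityMeasure_mix (ht0 n) (ht1 n) μ ν
      exact (hp.measurable_outputDensity.mul (Real.measurable_log.comp
        (hp.measurable_outputDensity.div hp.measurable_outputDensity))).aestronglyMeasurable
    · refine hp.integrable_outputDensity_mul hνs (A := 2 * A + A')
        (Continuous.measurable (by unfold sqNorm; fun_prop)) (by positivity) fun y => ?_
      have := sqNorm_nonneg y
      exact (abs_of_nonneg (by positivity)).le
    · rw [Real.norm_eq_abs, abs_mul, abs_of_pos (hg.pos y)]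
      refine mul_le_mul_of_nonneg_left ?_ (hg.pos y).le
      have hpos : 0 < outputDensity p (mix (1 / ((n : ℝ) + 2)) μ ν) y := by
        have := isProbabilityMeasure_mix (ht0 n) (ht1 n) μ ν
        exact hp.tameDensity_outputDensity.pos y
      rw [Real.log_div hpos.ne' (hf.pos y).ne']
      have h1 := abs_sub (Real.log (outputDensity p (mix (1 / ((n : ℝ) + 2)) μ ν) y))
        (Real.log (outputDensity p μ y))
      rw [hmixeq _ (ht0 n) (ht1 n)] at h1 ⊢
      have h2 := abs_log_convexComb_le (hf.pos y) (hg.pos y) (ht0 n) (ht1 n)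
      linarith [hA y, hA' y]
    · refine Tendsto.const_mul _ ?_
      simp_rw [fun n => hmixeq _ (ht0 n) (ht1 n) y]
      have htn : Tendsto (fun n : ℕ => 1 / ((n : ℝ) + 2)) atTop (𝓝 0) :=
        tendsto_const_nhds.div_atTop
          (tendsto_atTop_add_const_right _ _ tendsto_natCast_atTop_atTop)
      have hcont : ContinuousAt (fun t : ℝ => Real.log (((1 - t) * outputDensity p μ y
          + t * outputDensity p ν y) / outputDensity p μ y)) 0 := by
        refine ContinuousAt.log (Continuous.continuousAt (by fun_prop)) ?_
        simp [(hf.pos y).ne']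
      have := hcont.tendsto.comp htn
      simpa [(hf.pos y).ne', Function.comp_def] using this
  simp only [mul_zero, integral_zero] at hlim
  have := (tendsto_const_nhds (x := mutualInformation p μ)).add hlim
  rw [add_zero] at this
  refine ge_of_tendsto' this fun n => key _ (by positivity) ?_
  rw [div_lt_one (by positivity)]
  have : (0 : ℝ) ≤ n := by positivity
  linarith

lemma exists_multiplier_of_isMaxOn (hp : TameKernel p) (hN : 1 ≤ N) {a : ℝ} (ha : 0 < a)
    {μ : Measure (Fin N → ℂ)} (hμ : μ ∈ inputs N a)
    (hmax : IsMaxOn (mutualInformation p) (inputs N a) μ) :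
    ∃ γ, 0 ≤ γ ∧ ∀ x, divergence p (outputDensity p μ) x
      ≤ γ * (power x - a) + mutualInformation p μ := by
  refine exists_multiplier (x₀ := (0 : Fin N → ℂ)) (by simpa [power_eq, sqNorm] using ha)
    (fun x hx => ?_) fun x₁ x₂ t h0 h1 h => ?_
  · simpa using hp.integral_divergence_le_of_isMaxOn hN hμ (dirac_mem_inputs hx) hmax
  · have hi : ∀ (g : (Fin N → ℂ) → ℝ) x, Integrable g (Measure.dirac x) := fun g x =>
      integrable_dirac (by simp)
    have := hp.integral_divergence_le_of_isMaxOn hN hμ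
      (mix_mem_inputs h0 h1 (hi _ x₁) (hi _ x₂) (by simpa using h)) hmax
    rw [integral_mix h0 h1 (hi _ _) (hi _ _)] at this
    simpa using this

/-- Complementary slackness, with `i = divergence p f_μ`: the gap in the inequality has
nonpositive mean under `μ`, so that it vanishes almost everywhere and, being continuous, on the
support. -/
lemma eq_of_mem_support (hp : TameKernel p) (hN : 1 ≤ N) {a γ : ℝ} (hγ : 0 ≤ γ)
    {μ : Measure (Fin N → ℂ)} (hμ : μ ∈ inputs N a)
    (h : ∀ x, divergence p (outputDensity p μ) x ≤ γ * (power x - a) + mutualInformation p μ)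
    {x : Fin N → ℂ} (hx : x ∈ μ.support) :
    divergence p (outputDensity p μ) x = γ * (power x - a) + mutualInformation p μ := by
  have := hμ.1
  have hf := hp.tameDensity_outputDensity (μ := μ)
  have hi := hp.integrable_divergence hf (integrable_sqNorm_of_mem_inputs hN hμ)
  have hpa : Integrable (fun x => γ * (power x - a)) μ :=
    (hμ.2.1.sub (integrable_const a)).const_mul γ
  have hl : Integrable (fun x => γ * (power x - a) + mutualInformation p μ) μ :=
    hpa.add (integrable_const _)
  have hle : ∫ x, (γ * (power x - a) + mutualInformation p μ
      - divergence p (outputDensity p μ) x) ∂μ ≤ 0 := by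
    rw [integral_sub hl hi, integral_add hpa (integrable_const _), integral_const_mul,
      integral_sub hμ.2.1 (integrable_const a)]
    simp only [integral_const, probReal_univ, one_smul]
    change _ - mutualInformation p μ ≤ 0
    nlinarith [hμ.2.2]
  have hnn : ∀ x, 0 ≤ γ * (power x - a) + mutualInformation p μ
      - divergence p (outputDensity p μ) x := fun x => sub_nonneg.2 (h x)
  have hae := (integral_eq_zero_iff_of_nonneg hnn (hl.sub hi)).1
    (le_antisymm hle (integral_nonneg hnn))
  have hclosed : IsClosed {x | divergence p (outputDensity p μ) x
      = γ * (power x - a) + mutualInformation p μ} :=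
    isClosed_eq (hp.continuous_divergence hf)
      ((continuous_const.mul (continuous_power.sub continuous_const)).add continuous_const)
  refine Measure.support_subset_of_isClosed hclosed ?_ hx
  filter_upwards [hae] with z hz
  simp only [Pi.zero_apply] at hz
  linarith

/-! ### Unboundedness of the divergence -/

/-- The output density has a finite second moment, so that it also carries a finite weight
`1 + ‖y‖²`. Comparing with the weighted density gains `∫ p(y|x) log (1 + ‖y‖²) dy`, which tends to
infinity with `x`. -/
lemma exists_lt_divergence (hp : TameKernel p) (hN : 1 ≤ N) {μ : Measure (Fin N → ℂ)}
    [IsProbabilityMeasure μ] (hμ : Integrable sqNorm μ) (C : ℝ) :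
    ∃ x, C < divergence p (outputDensity p μ) x := by
  have hf := hp.tameDensity_outputDensity (μ := μ)
  set f := outputDensity p μ with hf_def
  have hw : ∀ y : Fin M → ℂ, 0 < 1 + sqNorm y := fun y => by
    have := sqNorm_nonneg y
    linarith
  set q : (Fin M → ℂ) → ℝ := fun y => f y * (1 + sqNorm y) with hq_def
  have hq : TameDensity q := by
    obtain ⟨A, hA0, hA⟩ := hf.abs_log_le
    refine ⟨hf.measurable.mul (measurable_const.add measurable_sqNorm),
      fun y => mul_pos (hf.pos y) (hw y), A + 1, by positivity, fun y => ?_⟩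
    rw [hq_def, Real.log_mul (hf.pos y).ne' (hw y).ne']
    have h1 := Real.log_le_sub_one_of_pos (hw y)
    have h2 : 0 ≤ Real.log (1 + sqNorm y) := Real.log_nonneg (by linarith [sqNorm_nonneg y])
    have h3 := abs_add_le (Real.log (f y)) (Real.log (1 + sqNorm y))
    rw [abs_of_nonneg h2] at h3
    linarith [hA y]
  have hqi : Integrable q := hp.integrable_outputDensity_mul hμ (A := 1)
    (measurable_const.add measurable_sqNorm) zero_le_one fun y => by
      rw [abs_of_pos (hw y), one_mul]
  obtain ⟨c, s, hc, hs, hspread⟩ := hp.spread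
  have hlow : ∀ x, c * Real.log (1 + s * sqNorm x) + (1 - ∫ y, q y) ≤ divergence p f x := by
    intro x
    have h1 := integral_sub_integral_le (hp.pos x) hq.pos (hp.integrable x) hqi
      (hp.integrable_mul_log_div hq x)
    have h2 := hp.divergence_sub_divergence hf hq x
    have h3 : ∀ y, q y / f y = 1 + sqNorm y := fun y => by
      have := (hf.pos y).ne'
      simp only [hq_def]
      field_simp
    simp_rw [h3] at h2
    rw [hp.integral_eq_one] at h1
    change _ ≤ divergence p q x at h1
    linarith [hspread x]
  obtain ⟨L, hL⟩ : ∃ L, C < c * L + (1 - ∫ y, q y) :=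
    ⟨(C - (1 - ∫ y, q y)) / c + 1, by rw [mul_add, mul_div_cancel₀ _ hc.ne']; linarith⟩
  set r := Real.exp L / s with hr
  have hr0 : 0 ≤ r := by positivity
  refine ⟨fun _ => (Real.sqrt r : ℂ), hL.trans_le (le_trans ?_ (hlow _))⟩
  have hx : sqNorm (fun _ : Fin N => (Real.sqrt r : ℂ)) = N * r := by
    simp [sqNorm, Real.sq_sqrt hr0]
  rw [hx]
  have hN' : (1 : ℝ) ≤ N := by exact_mod_cast hN
  have : L ≤ Real.log (1 + s * (N * r)) := by
    rw [Real.le_log_iff_exp_le (by positivity)]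
    have h1 : Real.exp L = s * r := by rw [hr]; field_simp
    rw [h1]
    nlinarith [mul_nonneg hs.le hr0]
  have := mul_le_mul_of_nonneg_left this hc.le
  linarith

end TameKernel

/-! ### Quadratic forms of Hermitian matrices -/

lemma sqNorm_eq_dotProduct {n : ℕ} (y : Fin n → ℂ) : (sqNorm y : ℂ) = star y ⬝ᵥ y := by
  simp [sqNorm, dotProduct, Complex.conj_mul']

/-- In an orthonormal basis of eigenvectors, in which `w` has coordinates `z`, a Hermitian form is
diagonal. -/
lemma exists_diagonal_coordinates {ι : Type*} [Fintype ι] [DecidableEq ι] {A : Matrix ι ι ℂ}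
    (hA : A.IsHermitian) (w : ι → ℂ) : ∃ z : ι → ℂ, ∑ i, ‖z i‖ ^ 2 = ∑ i, ‖w i‖ ^ 2 ∧
      star w ⬝ᵥ (A *ᵥ w) = ((∑ i, hA.eigenvalues i * ‖z i‖ ^ 2 : ℝ) : ℂ) := by
  set U : Matrix ι ι ℂ := (hA.eigenvectorUnitary : Matrix ι ι ℂ) with hU
  have hUU : U * Uᴴ = 1 := Unitary.coe_mul_star_self hA.eigenvectorUnitary
  have hspec : A = U * Matrix.diagonal (RCLike.ofReal ∘ hA.eigenvalues) * Uᴴ := by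
    conv_lhs => rw [hA.spectral_theorem, Unitary.conjStarAlgAut_apply]
    rfl
  have hform : ∀ D : Matrix ι ι ℂ, star w ⬝ᵥ ((U * D * Uᴴ) *ᵥ w)
      = star (Uᴴ *ᵥ w) ⬝ᵥ (D *ᵥ (Uᴴ *ᵥ w)) := by
    intro D
    rw [Matrix.star_mulVec, Matrix.conjTranspose_conjTranspose, ← Matrix.dotProduct_mulVec,
      Matrix.mulVec_mulVec, Matrix.mulVec_mulVec]
  refine ⟨Uᴴ *ᵥ w, ?_, ?_⟩
  · have h1 := hform 1
    rw [mul_one, hUU, Matrix.one_mulVec, Matrix.one_mulVec] at h1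
    have h2 : ∀ v : ι → ℂ, star v ⬝ᵥ v = ((∑ i, ‖v i‖ ^ 2 : ℝ) : ℂ) := fun v => by
      simp [dotProduct, Complex.conj_mul']
    rw [h2, h2] at h1
    exact_mod_cast h1.symm
  · conv_lhs => rw [hspec]
    rw [hform, dotProduct]
    push_cast
    refine Finset.sum_congr rfl fun i _ => ?_
    rw [Matrix.mulVec_diagonal, ← Complex.conj_mul']
    simp only [Pi.star_apply, RCLike.star_def, Function.comp_apply]
    change _ * (((hA.eigenvalues i : ℝ) : ℂ) * _) = _
    ring

lemma exists_bounds_of_posDef {ι : Type*} [Fintype ι] [DecidableEq ι] {A : Matrix ι ι ℂ}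
    (hA : A.PosDef) : ∃ l L : ℝ, 0 < l ∧ 0 ≤ L ∧ ∀ w : ι → ℂ,
      l * ∑ i, ‖w i‖ ^ 2 ≤ (star w ⬝ᵥ (A *ᵥ w)).re ∧
        (star w ⬝ᵥ (A *ᵥ w)).re ≤ L * ∑ i, ‖w i‖ ^ 2 := by
  obtain ⟨l, hl0, hl⟩ : ∃ l : ℝ, 0 < l ∧ ∀ i, l ≤ hA.1.eigenvalues i := by
    cases isEmpty_or_nonempty ι
    · exact ⟨1, one_pos, fun i => isEmptyElim i⟩
    · obtain ⟨i₀, hi₀⟩ := Finite.exists_min hA.1.eigenvalues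
      exact ⟨_, hA.eigenvalues_pos i₀, hi₀⟩
  refine ⟨l, ∑ i, hA.1.eigenvalues i, hl0,
    Finset.sum_nonneg fun i _ => (hA.eigenvalues_pos i).le, fun w => ?_⟩
  obtain ⟨z, hz, hq⟩ := exists_diagonal_coordinates hA.1 w
  rw [hq, Complex.ofReal_re, ← hz, Finset.mul_sum, Finset.mul_sum]
  refine ⟨Finset.sum_le_sum fun i _ => mul_le_mul_of_nonneg_right (hl i) (sq_nonneg _),
    Finset.sum_le_sum fun i _ => mul_le_mul_of_nonneg_right ?_ (sq_nonneg _)⟩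
  exact Finset.single_le_sum (f := hA.1.eigenvalues) (fun j _ => (hA.eigenvalues_pos j).le)
    (Finset.mem_univ i)

/-- Bounds on a Hermitian form bound the eigenvalues, hence the determinant. -/
lemma det_bounds {n : ℕ} {A : Matrix (Fin n) (Fin n) ℂ} (hA : A.PosDef) {l L : ℝ} (hl0 : 0 ≤ l)
    (h : ∀ z : Fin n → ℂ, l * sqNorm z ≤ (star z ⬝ᵥ (A *ᵥ z)).re ∧
      (star z ⬝ᵥ (A *ᵥ z)).re ≤ L * sqNorm z) :
    l ^ n ≤ A.det.re ∧ A.det.re ≤ L ^ n := by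
  have hdet : A.det.re = ∏ i, hA.1.eigenvalues i := by
    rw [hA.1.det_eq_prod_eigenvalues]
    exact_mod_cast Complex.ofReal_re (∏ i, hA.1.eigenvalues i)
  have heig : ∀ i, l ≤ hA.1.eigenvalues i ∧ hA.1.eigenvalues i ≤ L := by
    intro i
    have h1 := h (hA.1.eigenvectorBasis i)
    have h2 : sqNorm (hA.1.eigenvectorBasis i) = 1 := by
      have := EuclideanSpace.norm_sq_eq (hA.1.eigenvectorBasis i)
      rw [hA.1.eigenvectorBasis.norm_eq_one] at this
      rw [sqNorm, ← this, one_pow]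
    have h3 := hA.1.eigenvalues_eq i
    rw [h2, mul_one, mul_one] at h1
    rw [h3]
    exact h1
  rw [hdet]
  constructor
  · simpa using Finset.prod_le_prod (s := Finset.univ) (f := fun _ : Fin n => l)
      (fun _ _ => hl0) fun i _ => (heig i).1
  · simpa using Finset.prod_le_prod (s := Finset.univ) (g := fun _ : Fin n => L)
      (fun i _ => hl0.trans (heig i).1) fun i _ => (heig i).2

open scoped MatrixOrder in
/-- A positive definite matrix is the square of an invertible Hermitian matrix. -/
lemma exists_hermitian_sqrt {n : ℕ} {A : Matrix (Fin n) (Fin n) ℂ} (hA : A.PosDef) :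
    ∃ B : Matrix (Fin n) (Fin n) ℂ, Bᴴ = B ∧ B * B = A ∧ IsUnit B.det := by
  refine ⟨CFC.sqrt A, (Matrix.nonneg_iff_posSemidef.1 (CFC.sqrt_nonneg A)).1,
    CFC.sqrt_mul_sqrt_self A hA.posSemidef.nonneg, ?_⟩
  have h : (CFC.sqrt A).det * (CFC.sqrt A).det = A.det := by
    rw [← Matrix.det_mul, CFC.sqrt_mul_sqrt_self A hA.posSemidef.nonneg]
  rw [isUnit_iff_ne_zero]
  intro h0
  rw [h0, mul_zero] at h
  exact hA.det_pos.ne h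

/-- A complex matrix `B` changes the Lebesgue measure of `ℂⁿ` by the factor `|det B|²`. -/
lemma integral_comp_mulVec {n : ℕ} (B : Matrix (Fin n) (Fin n) ℂ) (hB : IsUnit B.det)
    {F : (Fin n → ℂ) → ℝ} (hF : Continuous F) :
    ∫ z, F (B *ᵥ z) = (‖B.det‖ ^ 2)⁻¹ * ∫ y, F y := by
  set f : (Fin n → ℂ) →ₗ[ℝ] (Fin n → ℂ) := (Matrix.toLin' B).restrictScalars ℝ with hf
  have hdet : LinearMap.det f = ‖B.det‖ ^ 2 := by
    rw [hf, LinearMap.det_restrictScalars, LinearMap.det_toLin', Algebra.norm_complex_apply,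
      Complex.normSq_eq_norm_sq]
  have hne : LinearMap.det f ≠ 0 := by
    rw [hdet]
    exact pow_ne_zero _ (norm_ne_zero_iff.2 hB.ne_zero)
  have hmap := Measure.map_linearMap_addHaar_eq_smul_addHaar (volume : Measure (Fin n → ℂ)) hne
  have hfc : Continuous f := f.continuous_of_finiteDimensional
  have := integral_map (μ := (volume : Measure (Fin n → ℂ))) hfc.measurable.aemeasurable
    (hF.aestronglyMeasurable (μ := Measure.map f volume))
  rw [hmap, integral_smul_measure, ENNReal.toReal_ofReal (abs_nonneg _), hdet,
    abs_of_nonneg (by positivity), smul_eq_mul] at this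
  exact this.symm

/-! ### The Rayleigh fading density -/

lemma idKron_mulVec {M N : ℕ} (x : Fin N → ℂ) (v : Fin M → ℂ) :
    idKron M x *ᵥ v = fun i => v i.1 * x i.2 := by
  ext ⟨m, n⟩
  simp [idKron, Matrix.mulVec, dotProduct, Matrix.one_apply, mul_comm]

lemma sum_norm_idKron_mulVec {M N : ℕ} (x : Fin N → ℂ) (v : Fin M → ℂ) :
    ∑ i, ‖(idKron M x *ᵥ v) i‖ ^ 2 = sqNorm x * sqNorm v := by
  simp only [idKron_mulVec, norm_mul, mul_pow, sqNorm]
  rw [Fintype.sum_prod_type, mul_comm, Finset.sum_mul_sum]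

section Density

variable {M N : ℕ} {σ2 : ℝ} {S : Matrix (Fin M × Fin N) (Fin M × Fin N) ℂ}

lemma posDef_outCov (hσ : 0 < σ2) (hS : S.PosDef) (x : Fin N → ℂ) : (outCov σ2 S x).PosDef := by
  refine Matrix.PosDef.add_posSemidef ?_ (hS.posSemidef.conjTranspose_mul_mul_same _)
  exact Matrix.PosDef.one.smul (by exact_mod_cast hσ)

lemma dotProduct_outCov (x : Fin N → ℂ) (v : Fin M → ℂ) :
    (star v ⬝ᵥ (outCov σ2 S x *ᵥ v)).re = σ2 * sqNorm v +
      (star (idKron M x *ᵥ v) ⬝ᵥ (S *ᵥ (idKron M x *ᵥ v))).re := by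
  rw [outCov, Matrix.add_mulVec, dotProduct_add, Complex.add_re, Matrix.smul_mulVec,
    Matrix.one_mulVec, dotProduct_smul, ← sqNorm_eq_dotProduct, smul_eq_mul, ← Complex.ofReal_mul,
    Complex.ofReal_re, Matrix.star_mulVec, ← Matrix.dotProduct_mulVec, Matrix.mulVec_mulVec,
    Matrix.mulVec_mulVec]

lemma outCov_bounds (hS : S.PosDef) : ∃ l L : ℝ, 0 < l ∧ 0 ≤ L ∧
    ∀ (x : Fin N → ℂ) (v : Fin M → ℂ),
      (σ2 + l * sqNorm x) * sqNorm v ≤ (star v ⬝ᵥ (outCov σ2 S x *ᵥ v)).re ∧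
        (star v ⬝ᵥ (outCov σ2 S x *ᵥ v)).re ≤ (σ2 + L * sqNorm x) * sqNorm v := by
  obtain ⟨l, L, hl, hL, h⟩ := exists_bounds_of_posDef hS
  refine ⟨l, L, hl, hL, fun x v => ?_⟩
  have := h (idKron M x *ᵥ v)
  rw [sum_norm_idKron_mulVec] at this
  rw [dotProduct_outCov]
  constructor <;> linarith [this.1, this.2]

/-- The exponent `tr [K(x)⁻¹ y yᴴ]` of the transition density. -/
def exponent (σ2 : ℝ) (S : Matrix (Fin M × Fin N) (Fin M × Fin N) ℂ) (x : Fin N → ℂ)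
    (y : Fin M → ℂ) : ℝ :=
  ((outCov σ2 S x)⁻¹ * Matrix.vecMulVec y (star y)).trace.re

lemma density_eq (x : Fin N → ℂ) (y : Fin M → ℂ) : density σ2 S x y =
    Real.exp (-exponent σ2 S x y) / (Real.pi ^ M * (outCov σ2 S x).det.re) := rfl

lemma continuous_outCov : Continuous fun x : Fin N → ℂ => outCov σ2 S x := by
  have h : Continuous fun x : Fin N → ℂ => idKron M x := by
    refine continuous_matrix fun i j => ?_
    simp only [idKron, Matrix.submatrix_apply, Matrix.kroneckerMap_apply,
      Matrix.replicateCol_apply, id]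
    fun_prop
  exact continuous_const.add ((h.matrix_conjTranspose.matrix_mul continuous_const).matrix_mul h)

lemma continuous_density (hσ : 0 < σ2) (hS : S.PosDef) :
    Continuous (Function.uncurry (density σ2 S)) := by
  have hK : Continuous fun z : (Fin N → ℂ) × (Fin M → ℂ) => outCov σ2 S z.1 :=
    continuous_outCov.comp continuous_fst
  have hne : ∀ z : (Fin N → ℂ) × (Fin M → ℂ), (outCov σ2 S z.1).det ≠ 0 :=
    fun z => (posDef_outCov hσ hS z.1).det_pos.ne'
  have hinv : Continuous fun z : (Fin N → ℂ) × (Fin M → ℂ) => (outCov σ2 S z.1)⁻¹ := by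
    simp only [Matrix.inv_def, Ring.inverse_eq_inv']
    exact (hK.matrix_det.inv₀ hne).smul hK.matrix_adjugate
  have hvec : Continuous fun z : (Fin N → ℂ) × (Fin M → ℂ) =>
      Matrix.vecMulVec z.2 (star z.2) := by
    refine continuous_matrix fun i j => ?_
    simp only [Matrix.vecMulVec_apply, Pi.star_apply]
    fun_prop
  have hexp : Continuous fun z : (Fin N → ℂ) × (Fin M → ℂ) => exponent σ2 S z.1 z.2 :=
    Complex.continuous_re.comp (hinv.matrix_mul hvec).matrix_trace
  refine (Real.continuous_exp.comp hexp.neg).div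
    (continuous_const.mul (Complex.continuous_re.comp hK.matrix_det)) fun z => ?_
  have := (Complex.pos_iff.1 (posDef_outCov hσ hS z.1).det_pos).1
  positivity

/-- Under `p(·|x)` the output is `T z` for a standard complex Gaussian vector `z`, where `T` is
the Hermitian square root of `K(x)`. -/
lemma exists_whitening (hσ : 0 < σ2) (hS : S.PosDef) (x : Fin N → ℂ) :
    ∃ T : (Fin M → ℂ) → (Fin M → ℂ), Continuous T ∧ Function.Surjective T ∧
      (∀ z, sqNorm (T z) = (star z ⬝ᵥ (outCov σ2 S x *ᵥ z)).re) ∧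
      (∀ z, exponent σ2 S x (T z) = sqNorm z) ∧
      ∀ F : (Fin M → ℂ) → ℝ, Continuous F → ∫ y, density σ2 S x y * F y =
        (Real.pi ^ M)⁻¹ * ∫ z, Real.exp (-sqNorm z) * F (T z) := by
  have hK := posDef_outCov hσ hS x
  obtain ⟨B, hBH, hBB, hBu⟩ := exists_hermitian_sqrt hK
  have hinv : ∀ z, B⁻¹ *ᵥ (B *ᵥ z) = z := fun z => by
    rw [Matrix.mulVec_mulVec, Matrix.nonsing_inv_mul B hBu, Matrix.one_mulVec]
  have hexp : ∀ z, exponent σ2 S x (B *ᵥ z) = sqNorm z := by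
    intro z
    rw [exponent, Matrix.mul_vecMulVec, Matrix.trace_vecMulVec, ← hBB, Matrix.mul_inv_rev,
      ← Matrix.mulVec_mulVec, hinv, dotProduct_comm, Matrix.star_mulVec, hBH,
      ← Matrix.dotProduct_mulVec, Matrix.mulVec_mulVec, Matrix.mul_nonsing_inv B hBu,
      Matrix.one_mulVec, ← sqNorm_eq_dotProduct, Complex.ofReal_re]
  have hdet : (outCov σ2 S x).det.re = ‖B.det‖ ^ 2 := by
    have h1 := Complex.pos_iff.1 hK.det_pos
    have h2 : ((outCov σ2 S x).det.re : ℂ) = (outCov σ2 S x).det :=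
      Complex.ext rfl (by simpa using h1.2)
    have h3 : ‖(outCov σ2 S x).det‖ = (outCov σ2 S x).det.re := by
      rw [← h2, Complex.norm_real, Real.norm_of_nonneg (by simpa using h1.1.le)]
      simp
    rw [← h3, ← hBB, Matrix.det_mul, norm_mul, sq]
  refine ⟨fun z => B *ᵥ z, by fun_prop, fun y => ⟨B⁻¹ *ᵥ y, ?_⟩, fun z => ?_, hexp,
    fun F hF => ?_⟩
  · change B *ᵥ (B⁻¹ *ᵥ y) = y
    rw [Matrix.mulVec_mulVec, Matrix.mul_nonsing_inv B hBu, Matrix.one_mulVec]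
  · rw [← hBB, ← Matrix.mulVec_mulVec, Matrix.dotProduct_mulVec]
    nth_rw 2 [← hBH]
    rw [← Matrix.star_mulVec, ← sqNorm_eq_dotProduct, Complex.ofReal_re]
  · have hc : Continuous fun y => density σ2 S x y * F y :=
      ((continuous_density hσ hS).comp
        (by fun_prop : Continuous fun y : Fin M → ℂ => (x, y))).mul hF
    have h1 := integral_comp_mulVec B hBu hc
    have hb : ‖B.det‖ ^ 2 ≠ 0 := pow_ne_zero _ (norm_ne_zero_iff.2 hBu.ne_zero)
    have h2 : ∀ z, density σ2 S x (B *ᵥ z) * F (B *ᵥ z)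
        = ((Real.pi ^ M)⁻¹ * (‖B.det‖ ^ 2)⁻¹) * (Real.exp (-sqNorm z) * F (B *ᵥ z)) := by
      intro z
      rw [density_eq, hexp, hdet, div_eq_mul_inv, mul_inv]
      ring
    simp_rw [h2] at h1
    rw [integral_const_mul, mul_comm (Real.pi ^ M)⁻¹, mul_assoc] at h1
    exact (mul_left_cancel₀ (inv_ne_zero hb) h1).symm

lemma exponent_bounds (hσ : 0 < σ2) (hS : S.PosDef) {L : ℝ} (hL : 0 ≤ L)
    (h : ∀ (x : Fin N → ℂ) (v : Fin M → ℂ), σ2 * sqNorm v ≤ (star v ⬝ᵥ (outCov σ2 S x *ᵥ v)).re ∧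
      (star v ⬝ᵥ (outCov σ2 S x *ᵥ v)).re ≤ (σ2 + L * sqNorm x) * sqNorm v)
    (x : Fin N → ℂ) (y : Fin M → ℂ) :
    sqNorm y / (σ2 + L * sqNorm x) ≤ exponent σ2 S x y ∧ exponent σ2 S x y ≤ sqNorm y / σ2 := by
  obtain ⟨T, -, hT, hq, he, -⟩ := exists_whitening hσ hS x
  obtain ⟨z, rfl⟩ := hT y
  have hx := sqNorm_nonneg x
  rw [he, hq, div_le_iff₀ (by positivity), le_div_iff₀ hσ]
  constructor <;> linarith [(h x z).1, (h x z).2]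

/-- For `t ≤ 1` this is Bernoulli's inequality `(1 + u) ^ t ≤ 1 + u * t`. -/
lemma min_mul_log_le {u t : ℝ} (hu : 0 ≤ u) (ht : 0 ≤ t) :
    min t 1 * Real.log (1 + u) ≤ Real.log (1 + u * t) := by
  rcases le_total t 1 with h | h
  · rw [min_eq_left h, ← Real.log_rpow (by positivity)]
    refine Real.log_le_log (by positivity) ?_
    have := rpow_one_add_le_one_add_mul_self (by linarith : -1 ≤ u) ht h
    linarith
  · rw [min_eq_right h, one_mul]
    exact Real.log_le_log (by positivity) (by nlinarith)

lemma integrable_exp_neg_sqNorm_mul {n : ℕ} {ψ : (Fin n → ℂ) → ℝ} (hψ : Continuous ψ) {A : ℝ}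
    (hA : ∀ z, |ψ z| ≤ A * (1 + sqNorm z)) :
    Integrable fun z => Real.exp (-sqNorm z) * ψ z := by
  refine Integrable.mono' ((integrable_one_add_sqNorm_mul_exp (n := n) one_pos).const_mul A)
    (Continuous.aestronglyMeasurable (by
      have := continuous_sqNorm (n := n)
      fun_prop)) (ae_of_all _ fun z => ?_)
  rw [Real.norm_eq_abs, abs_mul, abs_of_pos (Real.exp_pos _), one_mul]
  have := mul_le_mul_of_nonneg_left (hA z) (Real.exp_pos (-sqNorm z)).le
  linarith

lemma integral_exp_neg_sqNorm_mul_min_pos {n : ℕ} (hn : 1 ≤ n) :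
    0 < ∫ z : Fin n → ℂ, Real.exp (-sqNorm z) * min (sqNorm z) 1 := by
  have hnn : ∀ z : Fin n → ℂ, 0 ≤ Real.exp (-sqNorm z) * min (sqNorm z) 1 := fun z =>
    mul_nonneg (Real.exp_pos _).le (le_min (sqNorm_nonneg z) zero_le_one)
  rw [integral_pos_iff_support_of_nonneg hnn (integrable_exp_neg_sqNorm_mul (A := 1)
    (continuous_sqNorm.min continuous_const) fun z => by
      rw [abs_of_nonneg (le_min (sqNorm_nonneg z) zero_le_one)]
      linarith [min_le_left (sqNorm z) 1])]
  have hopen : IsOpen {z : Fin n → ℂ | 0 < sqNorm z} := isOpen_lt continuous_const continuous_sqNorm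
  have hne : {z : Fin n → ℂ | 0 < sqNorm z}.Nonempty := ⟨fun _ => 1, by
    have : (0 : ℝ) < n := by exact_mod_cast hn
    simpa [sqNorm] using this⟩
  refine (hopen.measure_pos volume hne).trans_le (measure_mono fun z hz => ?_)
  exact (mul_pos (Real.exp_pos _) (lt_min hz one_pos)).ne'

theorem tameKernel_density (hM : 1 ≤ M) (hσ : 0 < σ2) (hS : S.PosDef) :
    TameKernel (density σ2 S) := by
  obtain ⟨l, L, hl, hL, hlL⟩ := outCov_bounds (σ2 := σ2) hS
  have hform : ∀ (x : Fin N → ℂ) (v : Fin M → ℂ),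
      σ2 * sqNorm v ≤ (star v ⬝ᵥ (outCov σ2 S x *ᵥ v)).re ∧
        (star v ⬝ᵥ (outCov σ2 S x *ᵥ v)).re ≤ (σ2 + L * sqNorm x) * sqNorm v := by
    intro x v
    refine ⟨le_trans ?_ (hlL x v).1, (hlL x v).2⟩
    have : 0 ≤ l * sqNorm x := mul_nonneg hl.le (sqNorm_nonneg x)
    nlinarith [sqNorm_nonneg v]
  have hdet := fun x => det_bounds (posDef_outCov hσ hS x) hσ.le (hform x)
  have hdetpos : ∀ x, 0 < (outCov σ2 S x).det.re := fun x => (pow_pos hσ M).trans_le (hdet x).1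
  have hexp := exponent_bounds hσ hS hL hform
  have hle : ∀ x y, density σ2 S x y
      ≤ (Real.pi ^ M * σ2 ^ M)⁻¹ * Real.exp (-(sqNorm y / (σ2 + L * sqNorm x))) := by
    intro x y
    rw [density_eq, div_eq_mul_inv, mul_comm]
    refine mul_le_mul ?_ (Real.exp_le_exp.2 (neg_le_neg (hexp x y).1)) (Real.exp_pos _).le
      (by positivity)
    exact inv_anti₀ (by positivity) (mul_le_mul_of_nonneg_left (hdet x).1 (by positivity))
  refine ⟨continuous_density hσ hS, ?_, ?_, fun x => ?_, ?_, fun R => ?_, ?_⟩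
  · refine ⟨max 1 (Real.pi ^ M * σ2 ^ M)⁻¹, le_max_left _ _, fun x y => (hle x y).trans ?_⟩
    refine (mul_le_of_le_one_right (by positivity) (Real.exp_le_one_iff.2 ?_)).trans
      (le_max_right _ _)
    have h1 := sqNorm_nonneg x
    have h2 := sqNorm_nonneg y
    have : 0 ≤ sqNorm y / (σ2 + L * sqNorm x) := by positivity
    linarith
  · refine ⟨1 / σ2 + M * (Real.pi * (σ2 + L)), by positivity, fun x y => ?_⟩
    have h1 := sqNorm_nonneg x
    have h2 := sqNorm_nonneg y
    have hτ : 0 < Real.pi * (σ2 + L * sqNorm x) := by positivity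
    have h3 : Real.pi ^ M * (outCov σ2 S x).det.re
        ≤ Real.exp (M * (Real.pi * (σ2 + L * sqNorm x))) := by
      calc Real.pi ^ M * (outCov σ2 S x).det.re
          ≤ Real.pi ^ M * (σ2 + L * sqNorm x) ^ M :=
            mul_le_mul_of_nonneg_left (hdet x).2 (by positivity)
        _ = (Real.pi * (σ2 + L * sqNorm x)) ^ M := (mul_pow _ _ _).symm
        _ ≤ (Real.exp (Real.pi * (σ2 + L * sqNorm x))) ^ M := by
            refine pow_le_pow_left₀ hτ.le ?_ M
            linarith [Real.add_one_le_exp (Real.pi * (σ2 + L * sqNorm x))]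
        _ = _ := (Real.exp_nat_mul _ _).symm
    have h4 : 0 < Real.pi ^ M * (outCov σ2 S x).det.re := mul_pos (by positivity) (hdetpos x)
    rw [density_eq, le_div_iff₀ h4]
    calc _ ≤ Real.exp (-((1 / σ2 + M * (Real.pi * (σ2 + L))) * (1 + sqNorm x + sqNorm y)))
          * Real.exp (M * (Real.pi * (σ2 + L * sqNorm x))) :=
          mul_le_mul_of_nonneg_left h3 (Real.exp_pos _).le
      _ ≤ Real.exp (-(sqNorm y / σ2)) := by
          rw [← Real.exp_add, Real.exp_le_exp]
          have e1 : 0 ≤ 1 / σ2 * (1 + sqNorm x) := by positivity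
          have e2 : 0 ≤ M * (Real.pi * (σ2 + L)) * sqNorm y := by positivity
          have e3 : 0 ≤ M * (Real.pi * (L + σ2 * sqNorm x)) := by positivity
          have e4 : sqNorm y / σ2 = 1 / σ2 * sqNorm y := by ring
          rw [e4]
          nlinarith
      _ ≤ _ := Real.exp_le_exp.2 (neg_le_neg (hexp x y).2)
  · obtain ⟨T, -, -, -, -, hT⟩ := exists_whitening hσ hS x
    have h := hT (fun _ => 1) continuous_const
    have h0 := integral_exp_neg_sqNorm (n := M) one_pos
    simp only [one_mul, div_one] at h0
    simp only [mul_one, h0] at h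
    rw [h, inv_mul_cancel₀ (by positivity)]
  · set m := (Real.pi ^ M)⁻¹ * ∫ z : Fin M → ℂ, Real.exp (-sqNorm z) * sqNorm z with hm
    have hm0 : 0 ≤ m := mul_nonneg (by positivity)
      (integral_nonneg fun z => mul_nonneg (Real.exp_pos _).le (sqNorm_nonneg z))
    refine ⟨(σ2 + L) * m, by positivity, fun x => ?_⟩
    have hx := sqNorm_nonneg x
    obtain ⟨T, hTc, -, hq, -, hT⟩ := exists_whitening hσ hS x
    have hb : ∀ z, sqNorm (T z) ≤ (σ2 + L * sqNorm x) * sqNorm z := fun z => by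
      rw [hq]; exact (hform x z).2
    have hi : Integrable fun z : Fin M → ℂ => Real.exp (-sqNorm z) * sqNorm z :=
      integrable_exp_neg_sqNorm_mul continuous_sqNorm (A := 1) fun z => by
        rw [abs_of_nonneg (sqNorm_nonneg z)]
        linarith
    have hiT : Integrable fun z : Fin M → ℂ => Real.exp (-sqNorm z) * sqNorm (T z) := by
      refine integrable_exp_neg_sqNorm_mul (continuous_sqNorm.comp hTc)
        (A := σ2 + L * sqNorm x) fun z => ?_
      rw [abs_of_nonneg (sqNorm_nonneg _)]
      have : 0 < σ2 + L * sqNorm x := by positivity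
      linarith [hb z]
    calc ∫ y, density σ2 S x y * sqNorm y
        = (Real.pi ^ M)⁻¹ * ∫ z, Real.exp (-sqNorm z) * sqNorm (T z) := hT _ continuous_sqNorm
      _ ≤ (Real.pi ^ M)⁻¹ *
          ∫ z : Fin M → ℂ, (σ2 + L * sqNorm x) * (Real.exp (-sqNorm z) * sqNorm z) := by
          refine mul_le_mul_of_nonneg_left (integral_mono hiT (hi.const_mul _) fun z => ?_)
            (by positivity)
          have := mul_le_mul_of_nonneg_left (hb z) (Real.exp_pos (-sqNorm z)).le
          dsimp only
          linarith
      _ = (σ2 + L * sqNorm x) * m := by rw [integral_const_mul, hm]; ring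
      _ ≤ (σ2 + L) * m * (1 + sqNorm x) := by
          have : 0 ≤ (σ2 * sqNorm x + L) * m := by positivity
          linarith
  · refine ⟨(Real.pi ^ M * σ2 ^ M)⁻¹, 1 / (σ2 + L * |R|), by positivity, fun x hx y => ?_⟩
    refine (hle x y).trans (mul_le_mul_of_nonneg_left (Real.exp_le_exp.2 (neg_le_neg ?_))
      (by positivity))
    have h1 := sqNorm_nonneg x
    rw [one_div_mul_eq_div]
    refine div_le_div_of_nonneg_left (sqNorm_nonneg y) (by positivity) ?_
    have := mul_le_mul_of_nonneg_left (hx.trans (le_abs_self R)) hL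
    linarith
  · set c := ∫ z : Fin M → ℂ, Real.exp (-sqNorm z) * min (sqNorm z) 1 with hc
    have hc0 : 0 < c := integral_exp_neg_sqNorm_mul_min_pos hM
    refine ⟨(Real.pi ^ M)⁻¹ * c, l, by positivity, hl, fun x => ?_⟩
    have hx := sqNorm_nonneg x
    obtain ⟨T, hTc, -, hq, -, hT⟩ := exists_whitening hσ hS x
    -- With `y = T z`, `‖y‖² ≥ l ‖x‖² ‖z‖²`, and `log (1 + l ‖x‖² ‖z‖²)` is at least
    -- `min ‖z‖² 1 * log (1 + l ‖x‖²)`.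
    have hlogc : Continuous fun y : Fin M → ℂ => Real.log (1 + sqNorm y) :=
      (continuous_const.add continuous_sqNorm).log fun y =>
        (add_pos_of_pos_of_nonneg one_pos (sqNorm_nonneg y)).ne'
    have hi : Integrable fun z : Fin M → ℂ => Real.exp (-sqNorm z) * min (sqNorm z) 1 :=
      integrable_exp_neg_sqNorm_mul (continuous_sqNorm.min continuous_const) (A := 1) fun z => by
        rw [abs_of_nonneg (le_min (sqNorm_nonneg z) zero_le_one)]
        linarith [min_le_left (sqNorm z) 1]
    have hiT : Integrable fun z : Fin M → ℂ =>
        Real.exp (-sqNorm z) * Real.log (1 + sqNorm (T z)) := by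
      refine integrable_exp_neg_sqNorm_mul (hlogc.comp hTc)
        (A := σ2 + L * sqNorm x) fun z => ?_
      have h1 := sqNorm_nonneg (T z)
      have h2 := Real.log_le_sub_one_of_pos (by linarith : 0 < 1 + sqNorm (T z))
      have h3 := (hform x z).2
      have : 0 < σ2 + L * sqNorm x := by positivity
      rw [← hq] at h3
      rw [abs_of_nonneg (Real.log_nonneg (by linarith))]
      linarith
    rw [hT _ hlogc, mul_assoc]
    refine mul_le_mul_of_nonneg_left ?_ (by positivity)
    rw [hc, ← integral_mul_const]
    refine integral_mono (hi.mul_const _) hiT fun z => ?_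
    have h0 := sqNorm_nonneg z
    dsimp only
    rw [mul_assoc]
    refine mul_le_mul_of_nonneg_left ?_ (Real.exp_pos _).le
    refine (min_mul_log_le (mul_nonneg hl.le hx) h0).trans (Real.log_le_log (by positivity) ?_)
    rw [hq]
    have := (hlL x z).1
    nlinarith

end Density

end

end RayleighFading

theorem mainTheorem2 (M N : ℕ) (hM : 1 ≤ M) (hN : 1 ≤ N) (σ2 : ℝ) (hσ2 : 0 < σ2)
    (S : Matrix (Fin M × Fin N) (Fin M × Fin N) ℂ) (hS : S.PosDef) (a : ℝ) (ha : 0 < a) :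
    (∃ γ : ℝ, RayleighFading.IsLagrangeMultiplier σ2 S a γ) ∧
      ∀ γ : ℝ, RayleighFading.IsLagrangeMultiplier σ2 S a γ → 0 < γ := by
  have hp := RayleighFading.tameKernel_density (N := N) hM hσ2 hS
  constructor
  · obtain ⟨μ, hμ, hmax⟩ := hp.exists_isMaxOn_mutualInformation hN ha
    obtain ⟨γ, hγ, hle⟩ := hp.exists_multiplier_of_isMaxOn hN ha hμ hmax
    have hC : RayleighFading.mutualInfo σ2 S μ = RayleighFading.capacity σ2 S a :=
      (IsGreatest.csSup_eq ⟨Set.mem_image_of_mem _ hμ, by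
        rintro _ ⟨ν, hν, rfl⟩
        exact hmax hν⟩).symm
    refine ⟨γ, hγ, μ, ⟨hμ, hC⟩, fun x => ?_, fun x hx => ?_⟩
    · rw [RayleighFading.kkt, ← hC]
      exact sub_nonneg.2 (hle x)
    · rw [RayleighFading.kkt, ← hC]
      exact sub_eq_zero.2 (hp.eq_of_mem_support hN hγ hμ hle hx).symm
  · -- With `γ = 0` the conditions would bound the divergence by the capacity for all inputs.
    rintro γ ⟨hγ, μ, ⟨hμ, -⟩, hkkt, -⟩
    refine hγ.lt_of_ne' ?_
    rintro rfl
    have := hμ.1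
    obtain ⟨x, hx⟩ := hp.exists_lt_divergence hN
      (RayleighFading.integrable_sqNorm_of_mem_inputs hN hμ) (RayleighFading.capacity σ2 S a)
    have h := hkkt x
    rw [RayleighFading.kkt, zero_mul, zero_add] at h
    exact absurd (sub_nonneg.1 h) (not_le.2 hx)
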